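/- **Setting.** Let $M$ be a compact (connected) smooth Riemannian manifold of dimension $d$ with Riemannian distance $d(\cdot,\cdot)$ and volume $\mathrm{Vol}$, and let $f:M\to M$ be $C^2$ off its singular set $\mathcal S=\{x: f \text{ is not differentiable at } x\}$. Let $\mathcal C=\{x\notin\mathcal S:\ker Df(x)\neq 0\}$ be its critical set and write $Jf=|\det Df|$ for the Jacobian with respect to the Riemannian metric. Assume that the critical and singular points are non-degenerate: there are $\beta,A,k>0$ such that * if $\mathcal C\ne\emptyset$, then $0<\sup_{x\in V\setminus(\mathcal C\cup\mathcal S)}\|Df(x)^{-1}\|^{-1}/d(x,\mathcal C)^{\beta}<\infty$ for some open $V\supset\mathcal C$; * if $\mathcal S\neq\emptyset$, then $0<\sup_{x\in W\setminus\mathcal S}\|Df(x)\|/d(x,\mathcal S)^{-\beta}<\infty$ for some open $W\supset\mathcal S$; * $|\log Jf(x)-\log Jf(y)|\le A\,d(x,y)/d(x,\mathcal C\cup\mathcal S)^{k}$ for all $x,y\notin\mathcal C\cup\mathcal S$ with $d(x,y)\le d(x,\mathcal C\cup\mathcal S)/2$. Let $\mu$ be an ergodic $f$-invariant Borel probability with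 $\mu\ll\mathrm{Vol}$ which is expanding (for $\mu$-a.e. $x$ the limit $\lim_n\frac1n\log\|Df^n(x)v\|$ exists and is positive for all $v\in T_xM\setminus\{0\}$) and regular ($\mu(\mathcal C\cup\mathcal S)=0$ and $\int\max\{\log\|Df\|,\log\|Df^{-1}\|\}\,d\mu<\infty$). Let $\chi>0$ be its least Lyapunov exponent. Let $Z=\{(z_n)_{n\ge0}: f(z_{n+1})=z_n\}\subset M^{\mathbb N}$, $F(z_0,z_1,\dots)=(f(z_0),z_0,z_1,\dots)$ and $\pi(z)=z_0$, and let $\bar\mu$ be the lift of $\mu$ to $Z$, that is, the measure all of whose coordinate marginals are $\mu$. **Rectangles.** An open disc is an open subset of $M$ that is $C^2$ diffeomorphic to an open ball $B(x,r)\subset M$. A rectangle with base $B$ (an open disc) is a set $S\subset Z$ with a homeomorphism $\Phi:S\to B\times K$, where $K=S\cap\pi^{-1}(x_0)$ for some $x_0\in B$, such that the first component of $\Phi$ is $\pi$, $\Phi(w)=(x_0,w)$ for $w\in K$, and $\pi$ maps every plaque $\Phi^{-1}(B\times\{k\})$ diffeomorphically onto $B$ (the inverse $B\to Z\subset M^{\mathbb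 N}$ is $C^2$ in each coordinate). The plaque of $S$ through $z\in S$ is denoted by $S_z$. The height $K$ is required to be nonempty, totally disconnected, locally compact and without isolated points; thus $K$ is a Cantor set if it is compact, and a Cantor set minus one point otherwise. A subrectangle of a rectangle $\Sigma$ is a rectangle $S\subset\Sigma$ with $S_z=S\cap\Sigma_z$ for all $z\in S$; it is a $u$-rectangle of $\Sigma$ if $\Sigma_z\subset S$ for all $z\in S$. A map $F^n:S\to U$ between rectangles is a laminated diffeomorphism if it is a homeomorphism of $S$ onto $U$ that maps plaques onto plaques and if, in the parametrizations of the plaques by $\pi$, it is a $C^2$ diffeomorphism $f^n$ of the base of $S$ onto the base of $U$. **Regular returns.** A rectangle $\Sigma$ with base $B$ has regular returns with constant $C>0$ if for all $z,z'\in\Sigma$ and $n,m>0$: the sets $F^{-n}\Sigma_z$ and $F^{-m}\Sigma_{z'}$ are disjoint or nested, and so are their images under $\pi$; $\pi$ maps $F^{-n}\Sigma_z$ diffeomorphically onto $\pi F^{-n}\Sigma_z$; $f^n:\pi F^{-n}\Sigma_z\to B$ is a $C^2$ diffeomorphism; and for all $w,w'\in F^{-n}\Sigma_z$, $v\in T_{\pi(w)}M$,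 $$\|Df^n(\pi(w))v\|\ge C^{-1}e^{n\chi/2}\|v\|,\qquad \frac{Jf^n(\pi(w))}{Jf^n(\pi(w'))}\le e^{C\,d(f^n(\pi(w)),f^n(\pi(w')))},\qquad \prod_{i=0}^{\infty}\frac{Jf(\pi(F^{-i}w))}{Jf(\pi(F^{-i}w'))}\le e^{C\,d(\pi(w),\pi(w'))},$$ where the infinite product converges. **Statement.** Let $\Sigma$ be a rectangle whose height is a Cantor set, with regular returns with constant $C$, and with $\bar\mu(\Sigma)>0$. Let $\overline R(z)=\min\{n>0:F^n(z)\in\Sigma\}$ be the first return time and $\tau(z)=F^{\overline R(z)}(z)$ the first return map. Then there are a countable family of pairwise disjoint subrectangles $S_j$ of $\Sigma$, pairwise disjoint $u$-rectangles $U_j$ of $\Sigma$, and integers $\overline R_j>0$ such that 1. $\bar\mu(\Sigma\setminus\bigcup_jS_j)=\bar\mu(\Sigma\setminus\bigcup_jU_j)=0$; 2. for every $j$, $F^{\overline R_j}:S_j\to U_j$ is a laminated diffeomorphism, $\overline R=\overline R_j$ and $\tau=F^{\overline R_j}$ on $S_j$, and for all $z\in S_j$, all $w,w'\in S_j\cap\Sigma_z$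 and all $v\in T_{\pi(w)}M$, $$\|Df^{\overline R_j}(\pi(w))v\|\ge C^{-1}e^{\overline R_j\chi/3}\|v\|,\qquad \frac{Jf^{\overline R_j}(\pi(w))}{Jf^{\overline R_j}(\pi(w'))}\le\exp\bigl(C\,d(f^{\overline R_j}(\pi(w)),f^{\overline R_j}(\pi(w')))\bigr);$$ 3. for every $m>0$ there are only finitely many $j$ with $\overline R_j=m$. -/

import Mathlib

open MeasureTheory Set Filter Topology Manifold Bundle
open scoped ContDiff Bundle

noncomputable section

/-! ### The natural extension -/

section NaturalExtension

variable {M : Type*}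

/-- The phase space `Z` of the natural extension: the pre-orbits `(z₀, z₁, …)` of `f`, with
`f (zₙ₊₁) = zₙ`. Topology and `σ`-algebra are those inherited from the product `M^ℕ`. -/
abbrev PreOrbit (f : M → M) : Type _ := {z : ℕ → M // ∀ n, f (z (n + 1)) = z n}

/-- The projection `π` on the first coordinate. -/
def proj (f : M → M) (z : PreOrbit f) : M := z.1 0

/-- The map `F (z₀, z₁, …) = (f z₀, z₀, z₁, …)` with inverse `(z₀, z₁, …) ↦ (z₁, z₂, …)`. -/
def natExt (f : M → M) : PreOrbit f ≃ PreOrbit f where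
  toFun z := ⟨fun n => Nat.casesOn n (f (z.1 0)) z.1, fun n => by
    cases n with
    | zero => rfl
    | succ k => exact z.2 k⟩
  invFun z := ⟨fun n => z.1 (n + 1), fun n => z.2 (n + 1)⟩
  left_inv z := rfl
  right_inv z := by
    apply Subtype.ext
    funext n
    cases n with
    | zero => exact z.2 0
    | succ k => rfl

/-- The set `F⁻ⁿ P`. -/
def backImage (f : M → M) (n : ℕ) (P : Set (PreOrbit f)) : Set (PreOrbit f) :=
  (natExt f)^[n] ⁻¹' P

/-- `μbar` is the lift of `μ` to the natural extension: all its coordinate marginals are `μ`. (The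
first `n` coordinates of a pre-orbit are functions of the `n`-th one, so that there is at most one
such measure.) -/
def IsLift [MeasurableSpace M] (f : M → M) (μ : Measure M) (μbar : Measure (PreOrbit f)) : Prop :=
  ∀ n : ℕ, ∀ A : Set M, MeasurableSet A → μbar ((fun z : PreOrbit f => z.1 n) ⁻¹' A) = μ A

/-- The first return time to `S`, `min {n > 0 : Fⁿ z ∈ S}` (with value `0` if there is no
return). -/
def firstReturnTime (f : M → M) (S : Set (PreOrbit f)) (z : PreOrbit f) : ℕ :=
  sInf {n : ℕ | 0 < n ∧ (natExt f)^[n] z ∈ S}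

/-- The first return map `τ` to `S`. -/
def firstReturnMap (f : M → M) (S : Set (PreOrbit f)) (z : PreOrbit f) : PreOrbit f :=
  (natExt f)^[firstReturnTime f S z] z

/-- The part of `S ⊆ Z` in the vertical fibre `π⁻¹(x)`. -/
def crossSection (f : M → M) (S : Set (PreOrbit f)) (x : M) : Set (PreOrbit f) :=
  {w | w ∈ S ∧ proj f w = x}

/-- Two sets are disjoint or nested. -/
def DisjointOrNested {α : Type*} (A B : Set α) : Prop := Disjoint A B ∨ A ⊆ B ∨ B ⊆ A

end NaturalExtension

/-! ### Discs, plaques and rectangles -/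

section Rectangles

variable (d : ℕ) {M : Type*} [MetricSpace M] [ChartedSpace (EuclideanSpace ℝ (Fin d)) M]

/-- `g` restricts to a `C²` diffeomorphism of the open set `A` onto the open set `B`. -/
def IsDiffeoOn (g : M → M) (A B : Set M) : Prop :=
  IsOpen A ∧ IsOpen B ∧ ContMDiffOn (𝓡 d) (𝓡 d) 2 g A ∧
    ∃ h : M → M, ContMDiffOn (𝓡 d) (𝓡 d) 2 h B ∧
      MapsTo g A B ∧ MapsTo h B A ∧ InvOn h g A B

/-- An open disc: an open set which is diffeomorphic to an open ball of `M`. -/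
def IsOpenDisc (B : Set M) : Prop :=
  ∃ (x : M) (r : ℝ), 0 < r ∧ ∃ g : M → M, IsDiffeoOn d g B (Metric.ball x r)

/-- `π` restricts to a diffeomorphism of the plaque `P ⊆ Z` onto the open set `V ⊆ M`: it maps `P`
bijectively onto `V`, and the inverse `V → P ⊆ M^ℕ`, the parametrization of the plaque by a
sequence of inverse branches of the iterates of `f`, is `C²` in every coordinate. -/
def ProjIsDiffeo (f : M → M) (P : Set (PreOrbit f)) (V : Set M) : Prop :=
  IsOpen V ∧ BijOn (proj f) P V ∧
    ∀ n : ℕ, ∃ g : M → M, ContMDiffOn (𝓡 d) (𝓡 d) 2 g V ∧ ∀ w ∈ P, g (proj f w) = w.1 n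

/-- A (regular) rectangle. The height is the cross-section over a reference point `center` of the
base, and the chart is `Φ w = (π w, φ w)`, where `φ` is the holonomy along the plaques to the
cross-section over the reference point. The height is a nonempty, totally disconnected, locally
compact set without isolated points: if it is compact this says that it is a Cantor set, and
otherwise it is homeomorphic to a Cantor set without one point. -/
structure Rectangle (f : M → M) where
  carrier : Set (PreOrbit f)
  base : Set M
  isOpenDisc_base : IsOpenDisc d base
  center : M
  center_mem : center ∈ base
  nonempty_height : (crossSection f carrier center).Nonempty
  isTotallyDisconnected_height : IsTotallyDisconnected (crossSection f carrier center)
  preperfect_height : Preperfect (crossSection f carrier center)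
  locallyCompact_height : LocallyCompactSpace (crossSection f carrier center)
  chart : carrier ≃ₜ base × crossSection f carrier center
  chart_fst : ∀ w : carrier, ((chart w).1 : M) = proj f w
  chart_snd_center : ∀ w : crossSection f carrier center, (chart ⟨w.1, w.2.1⟩).2 = w
  projIsDiffeo_plaque : ∀ k : crossSection f carrier center,
    ProjIsDiffeo d f {w | ∃ hw : w ∈ carrier, (chart ⟨w, hw⟩).2 = k} base

namespace Rectangle

variable {d} {f : M → M}

/-- The height of a rectangle. -/
def height (S : Rectangle d f) : Set (PreOrbit f) := crossSection f S.carrier S.center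

/-- The plaque of `S` through the point `z` of `S`. -/
def plaque (S : Rectangle d f) (z : PreOrbit f) : Set (PreOrbit f) :=
  {w | ∃ (hw : w ∈ S.carrier) (hz : z ∈ S.carrier), (S.chart ⟨w, hw⟩).2 = (S.chart ⟨z, hz⟩).2}

/-- `S` is a subrectangle of `T`: a rectangle contained in `T` whose plaques are the intersections
of `S` with the plaques of `T`. -/
def IsSubrectangle (S T : Rectangle d f) : Prop :=
  S.carrier ⊆ T.carrier ∧ ∀ z ∈ S.carrier, S.plaque z = S.carrier ∩ T.plaque z

/-- `U` is a `u`-rectangle of `T`: a rectangle contained in `T` which contains the whole plaque of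
`T` through each of its points. -/
def IsURectangle (U T : Rectangle d f) : Prop :=
  U.IsSubrectangle T ∧ ∀ w ∈ U.carrier, U.carrier ∩ T.plaque w = T.plaque w

/-- `Fⁿ : S → U` is a laminated diffeomorphism: a homeomorphism which maps the plaques of `S` onto
plaques of `U`, diffeomorphically (in the parametrizations of the plaques by `π`, the restriction
of `Fⁿ` to a plaque is `fⁿ` from the base of `S` to the base of `U`). -/
def IsLaminatedDiffeo (n : ℕ) (S U : Rectangle d f) : Prop :=
  BijOn (natExt f)^[n] S.carrier U.carrier ∧
    ContinuousOn (natExt f)^[n] S.carrier ∧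
    ContinuousOn (natExt f).symm^[n] U.carrier ∧
    (∀ z ∈ S.carrier, (natExt f)^[n] '' S.plaque z = U.plaque ((natExt f)^[n] z)) ∧
    IsDiffeoOn d f^[n] S.base U.base

end Rectangle

end Rectangles

/-! ### Derivatives, exponents and non-degeneracy -/

section Riemannian

variable (d : ℕ) {M : Type*} [MetricSpace M] [ChartedSpace (EuclideanSpace ℝ (Fin d)) M]
  [IsManifold (𝓡 d) ∞ M] [RiemannianBundle (fun x : M => TangentSpace (𝓡 d) x)]

instance (x : M) : FiniteDimensional ℝ (TangentSpace (𝓡 d) x) :=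
  inferInstanceAs (FiniteDimensional ℝ (EuclideanSpace ℝ (Fin d)))

/-- The Jacobian `|det Df(x)|` with respect to the Riemannian metric, written as the square root of
`det (Df(x)* Df(x))`. -/
def riemJacobian (f : M → M) (x : M) : ℝ :=
  Real.sqrt (LinearMap.det
    ((mfderiv (𝓡 d) (𝓡 d) f x).toLinearMap.adjoint ∘ₗ (mfderiv (𝓡 d) (𝓡 d) f x).toLinearMap))

/-- The points at which `f` has no derivative. -/
def singularSet (f : M → M) : Set M := {x | ¬ MDifferentiableAt (𝓡 d) (𝓡 d) f x}

/-- The points at which `f` has a derivative with a nontrivial kernel. -/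
def criticalSet (f : M → M) : Set M :=
  {x | MDifferentiableAt (𝓡 d) (𝓡 d) f x ∧
    ∃ v : TangentSpace (𝓡 d) x, v ≠ 0 ∧ mfderiv (𝓡 d) (𝓡 d) f x v = 0}

/-- A `C²` transformation, possibly with singularities: `f` is `C²` off its singular set. -/
def IsC2Transformation (f : M → M) : Prop :=
  ∀ x, x ∉ singularSet d f → ContMDiffAt (𝓡 d) (𝓡 d) 2 f x

/-- The critical and singular points of `f` are non-degenerate. Each of the first two conditions is
void if there are no points of the kind in question, and the third one compares points `x`, `y`
that are closer to each other than `x` is to the critical and singular points. -/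
def IsNonDegenerate (f : M → M) : Prop :=
  ∃ β A k : ℝ, 0 < β ∧ 0 < A ∧ 0 < k ∧
    ((criticalSet d f).Nonempty → ∃ V : Set M, IsOpen V ∧ criticalSet d f ⊆ V ∧
      BddAbove ((fun x => ‖(mfderiv (𝓡 d) (𝓡 d) f x).inverse‖⁻¹ /
        Metric.infDist x (criticalSet d f) ^ β) '' (V \ (criticalSet d f ∪ singularSet d f))) ∧
      0 < sSup ((fun x => ‖(mfderiv (𝓡 d) (𝓡 d) f x).inverse‖⁻¹ /
        Metric.infDist x (criticalSet d f) ^ β) '' (V \ (criticalSet d f ∪ singularSet d f)))) ∧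
    ((singularSet d f).Nonempty → ∃ W : Set M, IsOpen W ∧ singularSet d f ⊆ W ∧
      BddAbove ((fun x => ‖mfderiv (𝓡 d) (𝓡 d) f x‖ /
        Metric.infDist x (singularSet d f) ^ (-β)) '' (W \ singularSet d f)) ∧
      0 < sSup ((fun x => ‖mfderiv (𝓡 d) (𝓡 d) f x‖ /
        Metric.infDist x (singularSet d f) ^ (-β)) '' (W \ singularSet d f))) ∧
    ∀ x y : M, x ∉ criticalSet d f ∪ singularSet d f → y ∉ criticalSet d f ∪ singularSet d f →
      dist x y ≤ Metric.infDist x (criticalSet d f ∪ singularSet d f) / 2 →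
      |Real.log (riemJacobian d f x) - Real.log (riemJacobian d f y)| ≤
        A * (dist x y / Metric.infDist x (criticalSet d f ∪ singularSet d f) ^ k)

/-- `l` is the Lyapunov exponent of the vector `v` at `x`: `‖Dfⁿ(x) v‖` has exponential growth
rate `l`. -/
def IsLyapunovExponent (f : M → M) (x : M) (v : TangentSpace (𝓡 d) x) (l : ℝ) : Prop :=
  Tendsto (fun n : ℕ => (1 / (n : ℝ)) * Real.log ‖mfderiv (𝓡 d) (𝓡 d) f^[n] x v‖) atTop (𝓝 l)

/-- At almost every point the Lyapunov exponents of all nonzero vectors exist and are positive. -/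
def IsExpandingMeasure [MeasurableSpace M] (f : M → M) (μ : Measure M) : Prop :=
  ∀ᵐ x ∂μ, ∀ v : TangentSpace (𝓡 d) x, v ≠ 0 → ∃ l : ℝ, 0 < l ∧ IsLyapunovExponent d f x v l

/-- `χ` is the least Lyapunov exponent of `μ`. -/
def IsLeastExponent [MeasurableSpace M] (f : M → M) (μ : Measure M) (χ : ℝ) : Prop :=
  ∀ᵐ x ∂μ, IsLeast
    {l : ℝ | ∃ v : TangentSpace (𝓡 d) x, v ≠ 0 ∧ IsLyapunovExponent d f x v l} χ

/-- `max {log ‖Df‖, log ‖Df⁻¹‖}` (a nonnegative function, defined off the critical and singular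
points, which have to be negligible) is integrable. -/
def IsRegularMeasure [MeasurableSpace M] (f : M → M) (μ : Measure M) : Prop :=
  μ (criticalSet d f ∪ singularSet d f) = 0 ∧
    ∫⁻ x, ENNReal.ofReal (max (Real.log ‖mfderiv (𝓡 d) (𝓡 d) f x‖)
      (Real.log ‖(mfderiv (𝓡 d) (𝓡 d) f x).inverse‖)) ∂μ < ⊤

/-- The Riemannian volume of a `d`-dimensional Riemannian manifold, as the `d`-dimensional Hausdorff
measure of the Riemannian distance (the two agree up to a constant factor that depends on `d`
only). -/
def riemVolume (d : ℕ) (M : Type*) [MetricSpace M] [MeasurableSpace M] [BorelSpace M] : Measure M :=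
  Measure.hausdorffMeasure (d : ℝ)

variable {d} in
/-- The rectangle `T` has the property of regular returns, with rate `χ` and constant `C`. -/
structure HasRegularReturns {f : M → M} (T : Rectangle d f) (χ C : ℝ) : Prop where
  nested : ∀ z ∈ T.carrier, ∀ z' ∈ T.carrier, ∀ n m : ℕ, 0 < n → 0 < m →
    DisjointOrNested (backImage f n (T.plaque z)) (backImage f m (T.plaque z'))
  nested_proj : ∀ z ∈ T.carrier, ∀ z' ∈ T.carrier, ∀ n m : ℕ, 0 < n → 0 < m →
    DisjointOrNested (proj f '' backImage f n (T.plaque z))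
      (proj f '' backImage f m (T.plaque z'))
  projIsDiffeo : ∀ z ∈ T.carrier, ∀ n : ℕ, 0 < n →
    ProjIsDiffeo d f (backImage f n (T.plaque z)) (proj f '' backImage f n (T.plaque z))
  isDiffeoOn : ∀ z ∈ T.carrier, ∀ n : ℕ, 0 < n →
    IsDiffeoOn d f^[n] (proj f '' backImage f n (T.plaque z)) T.base
  const_pos : 0 < C
  expansion : ∀ z ∈ T.carrier, ∀ n : ℕ, 0 < n → ∀ w ∈ backImage f n (T.plaque z),
    ∀ v : TangentSpace (𝓡 d) (proj f w),
      C⁻¹ * Real.exp (n * χ / 2) * ‖v‖ ≤ ‖mfderiv (𝓡 d) (𝓡 d) f^[n] (proj f w) v‖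
  forward_distortion : ∀ z ∈ T.carrier, ∀ n : ℕ, 0 < n →
    ∀ w ∈ backImage f n (T.plaque z), ∀ w' ∈ backImage f n (T.plaque z),
      riemJacobian d f^[n] (proj f w) / riemJacobian d f^[n] (proj f w') ≤
        Real.exp (C * dist (f^[n] (proj f w)) (f^[n] (proj f w')))
  backward_distortion : ∀ z ∈ T.carrier, ∀ n : ℕ, 0 < n →
    ∀ w ∈ backImage f n (T.plaque z), ∀ w' ∈ backImage f n (T.plaque z),
      ∃ p : ℝ, Tendsto (fun N : ℕ => ∏ i ∈ Finset.range N,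
          riemJacobian d f (proj f ((natExt f).symm^[i] w)) /
            riemJacobian d f (proj f ((natExt f).symm^[i] w'))) atTop (𝓝 p) ∧
        p ≤ Real.exp (C * dist (proj f w) (proj f w'))

end Riemannian

end

/-!
The idea is the Markov property: if `z` and `Fⁿ z` both lie in `Σ`, the pull-back of the plaque
through `Fⁿ z` is contained in the plaque through `z`. By nesting, the only alternative is that the
domain `W` of this branch of `fⁿ` contains the base `B`. But `fⁿ` maps `B` onto `B` in that case:
by uniform expansion and `μ ≪ Vol`, branches of high order are `μ`-small, so along a recurrent
orbit they nest inside those of lower order, which writes every point of `B` as `fⁿ` of a point of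
`B`. Hence `W ⊆ B`, as `fⁿ` is injective on `W`, and the plaques agree.

By the Markov property, whether `u ∈ Σ` returns backwards to `Σ` for the first time after `n` steps
depends only on the plaque of `u`, that is, on a height in the cross-section `K` of `Σ`. Nested
domains of branches of the same `fⁿ` coincide, so the domain is a locally constant function on `K`,
and by compactness it takes finitely many values `W`. Each pair `(n, W)` yields a locally closed
subset of `K`; cut down to the support of the transverse measure, which has no atoms because the
plaques are null sets, it has no isolated points. It is the height of a `u`-rectangle `U`, the
matching `S` is the pull-back of `U` by `Fⁿ`, and Poincaré recurrence for `F` and for `F⁻¹` shows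
that these rectangles exhaust `Σ`.
-/

open scoped NNReal ENNReal

theorem isContinuousRiemannianBundle_of_isContMDiffRiemannianBundle
    {E : Type*} [NormedAddCommGroup E] [NormedSpace ℝ E] {H : Type*} [TopologicalSpace H]
    (I : ModelWithCorners ℝ E H) (n : ℕ∞ω) {B : Type*} [TopologicalSpace B] [ChartedSpace H B]
    (F : Type*) [NormedAddCommGroup F] [NormedSpace ℝ F] (V : B → Type*)
    [TopologicalSpace (TotalSpace F V)] [∀ x, NormedAddCommGroup (V x)]
    [∀ x, InnerProductSpace ℝ (V x)] [FiberBundle F V] [VectorBundle ℝ F V]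
    [IsContMDiffRiemannianBundle I n F V] : IsContinuousRiemannianBundle F V := by
  obtain ⟨g, hg, hg_inner⟩ :=
    IsContMDiffRiemannianBundle.exists_contMDiff (IB := I) (n := n) (F := F) (E := V)
  exact ⟨g, hg.continuous, hg_inner⟩

section RiemannianLipschitz

variable {E : Type*} [NormedAddCommGroup E] [NormedSpace ℝ E]
  {H : Type*} [TopologicalSpace H] {I : ModelWithCorners ℝ E H}
  {N : Type*} [PseudoEMetricSpace N] [ChartedSpace H N]
  [RiemannianBundle (fun x : N => TangentSpace I x)]
  {E' : Type*} [NormedAddCommGroup E'] [NormedSpace ℝ E']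
  {H' : Type*} [TopologicalSpace H'] {I' : ModelWithCorners ℝ E' H'}
  {N' : Type*} [PseudoEMetricSpace N'] [ChartedSpace H' N']
  [RiemannianBundle (fun x : N' => TangentSpace I' x)] [IsRiemannianManifold I' N']

theorem edist_map_le_mul_pathELength {g : N → N'} {U : Set N} (hU : IsOpen U)
    (hg : ContMDiffOn I I' 1 g U) {K : ℝ≥0}
    (hK : ∀ y ∈ U, ∀ v : TangentSpace I y, ‖mfderiv I I' g y v‖ₑ ≤ K * ‖v‖ₑ)
    {γ : ℝ → N} (hγ : ContMDiffOn 𝓘(ℝ, ℝ) I 1 γ (Icc 0 1)) (hγU : MapsTo γ (Icc 0 1) U) :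
    edist (g (γ 0)) (g (γ 1)) ≤ K * pathELength I γ 0 1 := by
  rw [IsRiemannianManifold.out (I := I') (g (γ 0)) (g (γ 1))]
  refine (riemannianEDist_le_pathELength (γ := g ∘ γ) (hg.comp hγ hγU) rfl rfl
    zero_le_one).trans ?_
  rw [pathELength_eq_lintegral_mfderiv_Ioo, pathELength_eq_lintegral_mfderiv_Ioo,
    ← lintegral_const_mul' _ _ ENNReal.coe_ne_top]
  refine setLIntegral_mono' measurableSet_Ioo fun t ht => ?_
  have htI : t ∈ Icc (0 : ℝ) 1 := Ioo_subset_Icc_self ht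
  have hγt : MDifferentiableAt 𝓘(ℝ, ℝ) I γ t :=
    (hγ.contMDiffAt (Icc_mem_nhds ht.1 ht.2)).mdifferentiableAt one_ne_zero
  have hgt : MDifferentiableAt I I' g (γ t) :=
    (hg.contMDiffAt (hU.mem_nhds (hγU htI))).mdifferentiableAt one_ne_zero
  rw [mfderiv_comp t hgt hγt]
  exact hK _ (hγU htI) _

variable [IsRiemannianManifold I N]

variable (I) in
theorem exists_path_pathELength_lt_mapsTo_eball {y z : N} {c : ℝ≥0∞} (h : edist y z < c) :
    ∃ γ : ℝ → N, γ 0 = y ∧ γ 1 = z ∧ ContMDiffOn 𝓘(ℝ, ℝ) I 1 γ (Icc 0 1) ∧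
      pathELength I γ 0 1 < c ∧ MapsTo γ (Icc 0 1) (Metric.eball y c) := by
  rw [IsRiemannianManifold.out (I := I) y z] at h
  obtain ⟨γ, rfl, rfl, hγ, hlen⟩ := exists_lt_of_riemannianEDist_lt h
  refine ⟨γ, rfl, rfl, hγ, hlen, fun t ht => ?_⟩
  rw [Metric.mem_eball, edist_comm, IsRiemannianManifold.out (I := I) (γ 0) (γ t)]
  calc riemannianEDist I (γ 0) (γ t) ≤ pathELength I γ 0 t :=
        riemannianEDist_le_pathELength (hγ.mono (Icc_subset_Icc_right ht.2)) rfl rfl ht.1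
    _ ≤ pathELength I γ 0 1 := pathELength_mono le_rfl ht.2
    _ < c := hlen

theorem exists_lipschitzOnWith_of_enorm_mfderiv_le {g : N → N'} {U : Set N} (hU : IsOpen U)
    (hg : ContMDiffOn I I' 1 g U) {K : ℝ≥0}
    (hK : ∀ y ∈ U, ∀ v : TangentSpace I y, ‖mfderiv I I' g y v‖ₑ ≤ K * ‖v‖ₑ)
    {x : N} (hx : x ∈ U) : ∃ V ∈ 𝓝 x, LipschitzOnWith K g V := by
  obtain ⟨r, hr, hrU⟩ := EMetric.mem_nhds_iff.1 (hU.mem_nhds hx)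
  refine ⟨Metric.eball x (r / 3), Metric.eball_mem_nhds x (ENNReal.div_pos hr.ne' (by simp)),
    fun y hy z hz => ?_⟩
  rw [Metric.mem_eball] at hy hz
  have hyz : edist y z < r / 3 + r / 3 :=
    (edist_triangle_right _ _ x).trans_lt (ENNReal.add_lt_add hy hz)
  have edist_le : ∀ c ∈ Ioo (edist y z) (r / 3 + r / 3), edist (g y) (g z) ≤ K * c := by
    rintro c ⟨hc, hcr⟩
    obtain ⟨γ, rfl, rfl, hγ, hlen, hball⟩ := exists_path_pathELength_lt_mapsTo_eball I hc
    have hγU : MapsTo γ (Icc 0 1) U := fun t ht => hrU <| calc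
      edist (γ t) x ≤ edist (γ t) (γ 0) + edist (γ 0) x := edist_triangle _ _ _
      _ < r / 3 + r / 3 + r / 3 := ENNReal.add_lt_add ((hball ht).trans hcr) hy
      _ = r := ENNReal.add_thirds r
    exact (edist_map_le_mul_pathELength hU hg hK hγ hγU).trans (by gcongr)
  have : (𝓝[>] edist y z).NeBot := nhdsGT_neBot_of_exists_gt ⟨_, hyz⟩
  refine ge_of_tendsto (f := fun c : ℝ≥0∞ => K * c) (x := 𝓝[>] edist y z) ?_
    (mem_of_superset (Ioo_mem_nhdsGT hyz) edist_le)
  exact ((ENNReal.continuous_const_mul ENNReal.coe_ne_top).tendsto _).mono_left nhdsWithin_le_nhds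

end RiemannianLipschitz

theorem exists_lipschitzOnWith_extChartAt_symm {E : Type*} [NormedAddCommGroup E]
    [InnerProductSpace ℝ E] {H : Type*} [TopologicalSpace H] (I : ModelWithCorners ℝ E H)
    [I.Boundaryless] {N : Type*} [PseudoEMetricSpace N] [ChartedSpace H N] [IsManifold I 1 N]
    [RiemannianBundle (fun x : N => TangentSpace I x)]
    [IsContinuousRiemannianBundle E (fun x : N => TangentSpace I x)] [IsRiemannianManifold I N]
    (x : N) : ∃ K : ℝ≥0, ∃ V ∈ 𝓝 (extChartAt I x x), LipschitzOnWith K (extChartAt I x).symm V := by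
  obtain ⟨K, -, hK⟩ := eventually_enorm_mfderivWithin_symm_extChartAt_lt I x
  rw [I.range_eq_univ, nhdsWithin_univ] at hK
  obtain ⟨U, hUsub, hUo, hxU⟩ :=
    mem_nhds_iff.1 (inter_mem hK (extChartAt_target_mem_nhds (I := I) x))
  have hsm : ContMDiffOn 𝓘(ℝ, E) I 1 (extChartAt I x).symm U :=
    (contMDiffOn_extChartAt_symm x).mono fun y hy => (hUsub hy).2
  refine ⟨K, exists_lipschitzOnWith_of_enorm_mfderiv_le hUo hsm (fun y hy v => ?_) hxU⟩
  have hy' := (hUsub hy).1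
  rw [mem_ofPred_eq, mfderivWithin_univ] at hy'
  rw [enorm_tangentSpace_vectorSpace (v := v)]
  exact (ContinuousLinearMap.le_opENorm (E := E)
    (mfderiv 𝓘(ℝ, E) I (extChartAt I x).symm y) v).trans (mul_le_mul_left hy'.le _)

section HausdorffMeasure

theorem exists_partition_subset_of_mem_nhds {X : Type*} [TopologicalSpace X]
    [SecondCountableTopology X] [MeasurableSpace X] [OpensMeasurableSpace X] {U : Set X}
    (hU : MeasurableSet U) (hne : U.Nonempty) {V : X → Set X} (hV : ∀ x ∈ U, V x ∈ 𝓝 x) :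
    ∃ D : ℕ → Set X, (∀ n, MeasurableSet (D n)) ∧ Pairwise (Function.onFun Disjoint D) ∧
      ⋃ n, D n = U ∧ ∀ n, ∃ x ∈ U, D n ⊆ V x := by
  obtain ⟨t, htU, htc, hcov⟩ := TopologicalSpace.countable_cover_nhdsWithin
    (s := U) (f := fun x => interior (V x))
    (fun x hx => mem_nhdsWithin_of_mem_nhds (interior_mem_nhds.2 (hV x hx)))
  obtain ⟨x, hx⟩ := hne
  obtain ⟨i, hi, -⟩ := mem_iUnion₂.1 (hcov hx)
  obtain ⟨e, rfl⟩ := htc.exists_eq_range ⟨i, hi⟩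
  refine ⟨fun n => U ∩ disjointed (fun n => interior (V (e n))) n, fun n => ?_, fun i j hij => ?_,
    ?_, fun n => ⟨e n, htU (mem_range_self n), ?_⟩⟩
  · exact hU.inter (MeasurableSet.disjointed (fun i => isOpen_interior.measurableSet) n)
  · exact (disjoint_disjointed _ hij).mono inter_subset_right inter_subset_right
  · rw [← inter_iUnion, iUnion_disjointed, inter_eq_left]
    simpa using hcov
  · exact inter_subset_right.trans ((disjointed_subset _ n).trans interior_subset)

theorem hausdorffMeasure_image_le_of_locally_lipschitz {X Y : Type*} [EMetricSpace X]
    [SecondCountableTopology X] [MeasurableSpace X] [BorelSpace X] [EMetricSpace Y]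
    [MeasurableSpace Y] [BorelSpace Y] {g : X → Y} {U : Set X} (hU : MeasurableSet U) {K : ℝ≥0}
    (hg : ∀ x ∈ U, ∃ V ∈ 𝓝 x, LipschitzOnWith K g V) {s : ℝ} (hs : 0 ≤ s) :
    μH[s] (g '' U) ≤ (K : ℝ≥0∞) ^ s * μH[s] U := by
  rcases U.eq_empty_or_nonempty with rfl | hne
  · simp
  choose! V hV hgV using hg
  obtain ⟨D, hDm, hDd, hDU, hDV⟩ := exists_partition_subset_of_mem_nhds hU hne hV
  calc μH[s] (g '' U) = μH[s] (⋃ n, g '' D n) := by rw [← image_iUnion, hDU]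
    _ ≤ ∑' n, μH[s] (g '' D n) := measure_iUnion_le _
    _ ≤ ∑' n, (K : ℝ≥0∞) ^ s * μH[s] (D n) := by
      refine ENNReal.tsum_le_tsum fun n => ?_
      obtain ⟨x, hx, hDx⟩ := hDV n
      exact ((hgV x hx).mono hDx).hausdorffMeasure_image_le hs
    _ = (K : ℝ≥0∞) ^ s * μH[s] U := by rw [ENNReal.tsum_mul_left, ← measure_iUnion hDd hDm, hDU]

end HausdorffMeasure

section Volume

variable {d : ℕ} {M : Type*} [MetricSpace M] [ChartedSpace (EuclideanSpace ℝ (Fin d)) M]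

namespace IsDiffeoOn

variable {g g' : M → M} {A B D : Set M}

theorem bijOn (hg : IsDiffeoOn d g A B) : BijOn g A B := by
  obtain ⟨-, -, -, h, -, hgm, hhm, hinv⟩ := hg
  exact hinv.bijOn hgm hhm

theorem comp (hg' : IsDiffeoOn d g' B D) (hg : IsDiffeoOn d g A B) :
    IsDiffeoOn d (g' ∘ g) A D := by
  obtain ⟨hA, -, hgs, h, hhs, hgm, hhm, hinv⟩ := hg
  obtain ⟨-, hD, hgs', h', hhs', hgm', hhm', hinv'⟩ := hg'
  exact ⟨hA, hD, hgs'.comp hgs hgm, h ∘ h', hhs.comp hhs' hhm', hgm'.comp hgm, hhm.comp hhm',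
    hinv.comp hinv' hgm hhm'⟩

end IsDiffeoOn

theorem IsOpenDisc.of_isDiffeoOn {g : M → M} {A B : Set M} (hB : IsOpenDisc d B)
    (hg : IsDiffeoOn d g A B) : IsOpenDisc d A := by
  obtain ⟨x, r, hr, g', hg'⟩ := hB
  exact ⟨x, r, hr, g' ∘ g, hg'.comp hg⟩

variable [RiemannianBundle (fun x : M => TangentSpace (𝓡 d) x)]

theorem norm_mfderiv_apply_of_eventuallyEq_id {φ : M → M} {y : M} (h : φ =ᶠ[𝓝 y] id)
    (v : TangentSpace (𝓡 d) y) : ‖mfderiv (𝓡 d) (𝓡 d) φ y v‖ = ‖v‖ := by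
  have hφ : HasMFDerivAt (𝓡 d) (𝓡 d) φ y (ContinuousLinearMap.id ℝ (TangentSpace (𝓡 d) y)) :=
    (hasMFDerivAt_id y).congr_of_eventuallyEq h
  -- `mfderiv φ y v` is a tangent vector at `φ y`, which equals `y` only propositionally.
  have norm_congr : ∀ p : M, p = y → ∀ u : EuclideanSpace ℝ (Fin d),
      ‖(show TangentSpace (𝓡 d) p from u)‖ = ‖(show TangentSpace (𝓡 d) y from u)‖ := by
    rintro p rfl u
    rfl
  rw [hφ.mfderiv]
  exact norm_congr _ h.eq_of_nhds v

theorem norm_mfderiv_mfderiv_of_eventuallyEq_id {g h : M → M} {y : M}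
    (hh : MDifferentiableAt (𝓡 d) (𝓡 d) h y) (hg : MDifferentiableAt (𝓡 d) (𝓡 d) g (h y))
    (hgh : g ∘ h =ᶠ[𝓝 y] id) (v : TangentSpace (𝓡 d) y) :
    ‖mfderiv (𝓡 d) (𝓡 d) g (h y) (mfderiv (𝓡 d) (𝓡 d) h y v)‖ = ‖v‖ := by
  rw [← norm_mfderiv_apply_of_eventuallyEq_id hgh v, mfderiv_comp y hg hh]
  rfl

variable [IsRiemannianManifold (𝓡 d) M] [MeasurableSpace M] [BorelSpace M]

theorem riemVolume_le_of_expanding [SecondCountableTopology M] {g : M → M} {W B : Set M}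
    (hg : IsDiffeoOn d g W B) {c : ℝ} (hc : 0 < c)
    (hexp : ∀ x ∈ W, ∀ v : TangentSpace (𝓡 d) x,
      c * ‖v‖ ≤ ‖mfderiv (𝓡 d) (𝓡 d) g x v‖) :
    riemVolume d M W ≤ ENNReal.ofReal c⁻¹ ^ (d : ℝ) * riemVolume d M B := by
  obtain ⟨hW, hB, hgs, h, hhs, hgm, hhm, hinv⟩ := hg
  have hle : ∀ y ∈ B, ∀ v : TangentSpace (𝓡 d) y,
      ‖mfderiv (𝓡 d) (𝓡 d) h y v‖ₑ ≤ (Real.toNNReal c⁻¹ : ℝ≥0) * ‖v‖ₑ := by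
    intro y hy v
    have hh : MDifferentiableAt (𝓡 d) (𝓡 d) h y :=
      (hhs.contMDiffAt (hB.mem_nhds hy)).mdifferentiableAt two_ne_zero
    have hgd : MDifferentiableAt (𝓡 d) (𝓡 d) g (h y) :=
      (hgs.contMDiffAt (hW.mem_nhds (hhm hy))).mdifferentiableAt two_ne_zero
    have hgh : g ∘ h =ᶠ[𝓝 y] id := mem_of_superset (hB.mem_nhds hy) fun z hz => hinv.2 hz
    have hle : ‖mfderiv (𝓡 d) (𝓡 d) h y v‖ ≤ c⁻¹ * ‖v‖ := by
      rw [le_inv_mul_iff₀ hc, ← norm_mfderiv_mfderiv_of_eventuallyEq_id hh hgd hgh v]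
      exact hexp (h y) (hhm hy) _
    rw [← ofReal_norm, ← ofReal_norm, ← ENNReal.ofReal, ← ENNReal.ofReal_mul (by positivity)]
    exact ENNReal.ofReal_le_ofReal hle
  rw [← (hinv.symm.bijOn hhm hgm).image_eq]
  exact hausdorffMeasure_image_le_of_locally_lipschitz hB.measurableSet
    (fun x hx => exists_lipschitzOnWith_of_enorm_mfderiv_le hB (hhs.of_le (by norm_num)) hle hx)
    (Nat.cast_nonneg d)

variable (d M) in
theorem isLocallyFiniteMeasure_riemVolume [IsManifold (𝓡 d) 1 M]
    [IsContinuousRiemannianBundle (EuclideanSpace ℝ (Fin d))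
      (fun x : M => TangentSpace (𝓡 d) x)] :
    IsLocallyFiniteMeasure (riemVolume d M) := by
  refine ⟨fun x => ?_⟩
  obtain ⟨K, V, hV, hL⟩ := exists_lipschitzOnWith_extChartAt_symm (𝓡 d) x
  obtain ⟨r, hr, hrV⟩ := Metric.mem_nhds_iff.1 hV
  refine ⟨(extChartAt (𝓡 d) x).symm '' Metric.ball (extChartAt (𝓡 d) x x) r, ?_, ?_⟩
  · filter_upwards [extChartAt_source_mem_nhds (I := 𝓡 d) x,
      (continuousAt_extChartAt (I := 𝓡 d) x).preimage_mem_nhds (Metric.ball_mem_nhds _ hr)]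
      with y hy hyr
    exact ⟨_, hyr, (extChartAt (𝓡 d) x).left_inv hy⟩
  · have hball : μH[(d : ℝ)] (Metric.ball (extChartAt (𝓡 d) x x) r) < ⊤ := by
      have hd : ((Module.finrank ℝ (EuclideanSpace ℝ (Fin d)) : ℕ) : ℝ) = d := by
        rw [finrank_euclideanSpace_fin]
      rw [← hd]
      exact measure_ball_lt_top
    exact ((hL.mono hrV).hausdorffMeasure_image_le (Nat.cast_nonneg d)).trans_lt
      (ENNReal.mul_lt_top (ENNReal.rpow_lt_top_of_nonneg (Nat.cast_nonneg d)
        ENNReal.coe_ne_top) hball)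

end Volume

theorem exists_pos_forall_measure_lt_of_absolutelyContinuous {α : Type*} [MeasurableSpace α]
    {μ ν : Measure α} [IsFiniteMeasure μ] (h : μ ≪ ν) {ε : ℝ≥0∞} (hε : ε ≠ 0) :
    ∃ δ > 0, ∀ s, ν s < δ → μ s < ε := by
  by_contra! hcon
  choose s hνs hμs using fun n : ℕ => hcon ((2 : ℝ≥0∞)⁻¹ ^ n) (ENNReal.pow_pos (by simp) n)
  -- Borel–Cantelli: the limsup of the `s n` is null, but each of their tails has measure `≥ ε`.
  let t n := toMeasurable ν (s n)
  have limsup_null : μ (limsup t atTop) = 0 := by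
    refine h (measure_limsup_atTop_eq_zero (ne_top_of_le_ne_top ?_
      (ENNReal.tsum_le_tsum fun n => (measure_toMeasurable (s n)).trans_le (hνs n).le)))
    simp [ENNReal.tsum_geometric]
  rw [limsup_eq_iInf_iSup_of_nat'] at limsup_null
  refine hε (nonpos_iff_eq_zero.1 (limsup_null ▸ ?_))
  refine ge_of_tendsto' (tendsto_measure_iInter_atTop
    (fun n => (MeasurableSet.iUnion fun i => measurableSet_toMeasurable ν _).nullMeasurableSet)
    (antitone_nat_of_succ_le fun n => iUnion_subset fun i => ?_) ⟨0, measure_ne_top _ _⟩)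
    fun n => (hμs n).trans (measure_mono ?_)
  · rw [← add_assoc, add_right_comm]
    exact subset_iUnion_of_subset (i + 1) Subset.rfl
  · exact (subset_toMeasurable ν _).trans (subset_iUnion_of_subset 0 (by rw [Nat.zero_add]))

section NaturalExtension

variable {M : Type*} {f : M → M}

theorem natExt_iterate_symm_iterate (n : ℕ) (z : PreOrbit f) :
    (natExt f)^[n] ((natExt f).symm^[n] z) = z :=
  (natExt f).rightInverse_symm.iterate n z

theorem natExt_symm_iterate_iterate (n : ℕ) (z : PreOrbit f) :
    (natExt f).symm^[n] ((natExt f)^[n] z) = z :=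
  (natExt f).leftInverse_symm.iterate n z

theorem natExt_symm_iterate_apply (n i : ℕ) (z : PreOrbit f) :
    ((natExt f).symm^[n] z).1 i = z.1 (i + n) := by
  induction n generalizing z with
  | zero => rfl
  | succ n ih =>
    rw [Function.iterate_succ_apply, ih]
    rfl

theorem natExt_apply (z : PreOrbit f) (n : ℕ) : (natExt f z).1 n = f (z.1 n) := by
  cases n with
  | zero => rfl
  | succ n => exact (z.2 n).symm

theorem natExt_iterate_apply (n i : ℕ) (z : PreOrbit f) :
    ((natExt f)^[n] z).1 i = f^[n] (z.1 i) := by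
  induction n with
  | zero => rfl
  | succ n ih => rw [Function.iterate_succ_apply', natExt_apply, ih, Function.iterate_succ_apply']

theorem proj_natExt_iterate (n : ℕ) (z : PreOrbit f) :
    proj f ((natExt f)^[n] z) = f^[n] (proj f z) :=
  natExt_iterate_apply n 0 z

theorem natExt_iterate_apply_add (n i : ℕ) (z : PreOrbit f) :
    ((natExt f)^[n] z).1 (i + n) = z.1 i := by
  rw [← natExt_symm_iterate_apply, natExt_symm_iterate_iterate]

theorem natExt_iterate_add_apply (i j : ℕ) (z : PreOrbit f) :
    ((natExt f)^[i + j] z).1 i = f^[j] (proj f z) := by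
  rw [Function.iterate_add_apply, ← proj_natExt_iterate]
  have := natExt_iterate_apply_add i 0 ((natExt f)^[j] z)
  rwa [zero_add] at this

theorem PreOrbit.iterate_apply_add (z : PreOrbit f) (n i : ℕ) : f^[n] (z.1 (i + n)) = z.1 i := by
  rw [← natExt_iterate_apply, natExt_iterate_apply_add]

theorem mem_backImage {n : ℕ} {P : Set (PreOrbit f)} {w : PreOrbit f} :
    w ∈ backImage f n P ↔ (natExt f)^[n] w ∈ P := Iff.rfl

theorem symm_iterate_mem_backImage {n : ℕ} {P : Set (PreOrbit f)} {w : PreOrbit f} :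
    (natExt f).symm^[n] w ∈ backImage f n P ↔ w ∈ P := by
  rw [mem_backImage, natExt_iterate_symm_iterate]

theorem backImage_add (m n : ℕ) (P : Set (PreOrbit f)) :
    backImage f (m + n) P = backImage f m (backImage f n P) := by
  ext w
  rw [mem_backImage, mem_backImage, mem_backImage, add_comm, Function.iterate_add_apply]

theorem natExt_symm_iterate_iterate_of_le {m n : ℕ} (h : m ≤ n) (z : PreOrbit f) :
    (natExt f).symm^[m] ((natExt f)^[n] z) = (natExt f)^[n - m] z := by
  conv_lhs => rw [← Nat.add_sub_cancel' h, Function.iterate_add_apply]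
  exact natExt_symm_iterate_iterate m _

section Topology

variable [TopologicalSpace M]

theorem continuous_coord (n : ℕ) : Continuous fun z : PreOrbit f => z.1 n :=
  (continuous_apply n).comp continuous_subtype_val

theorem continuous_proj : Continuous (proj f) := continuous_coord 0

theorem continuous_natExt_symm_iterate (n : ℕ) : Continuous (natExt f).symm^[n] := by
  refine Continuous.subtype_mk (f := fun z => ((natExt f).symm^[n] z).1)
    (continuous_pi fun i => ?_) _
  simp only [natExt_symm_iterate_apply]
  exact continuous_coord _

end Topology

section Measure

variable [MeasurableSpace M]

theorem measurable_coord (n : ℕ) : Measurable fun z : PreOrbit f => z.1 n :=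
  (measurable_pi_apply n).comp measurable_subtype_coe

theorem measurable_natExt (hf : Measurable f) : Measurable (natExt f) := by
  refine Measurable.subtype_mk (f := fun z => (natExt f z).1)
    (measurable_pi_lambda _ fun i => ?_)
  simp only [natExt_apply]
  exact hf.comp (measurable_coord i)

theorem measurable_natExt_symm : Measurable (natExt f).symm :=
  Measurable.subtype_mk (f := fun z => ((natExt f).symm z).1)
    (measurable_pi_lambda _ fun i => measurable_coord (i + 1))

theorem generateFrom_coord_preimage :
    MeasurableSpace.generateFrom {s : Set (PreOrbit f) | ∃ (n : ℕ) (A : Set M),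
      MeasurableSet A ∧ (fun z : PreOrbit f => z.1 n) ⁻¹' A = s} = Subtype.instMeasurableSpace := by
  refine le_antisymm (MeasurableSpace.generateFrom_le ?_) ?_
  · rintro s ⟨n, A, hA, rfl⟩
    exact measurable_coord n hA
  · rw [Subtype.instMeasurableSpace, MeasurableSpace.pi, MeasurableSpace.comap_iSup]
    refine iSup_le fun n => ?_
    rw [MeasurableSpace.comap_comp]
    rintro s ⟨A, hA, rfl⟩
    exact MeasurableSpace.measurableSet_generateFrom ⟨n, A, hA, rfl⟩

namespace IsLift

variable {μ : Measure M} {μbar ν : Measure (PreOrbit f)}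

theorem measure_univ_eq (h : IsLift f μ μbar) : μbar univ = μ univ := by
  simpa using h 0 univ MeasurableSet.univ

theorem isFiniteMeasure [IsFiniteMeasure μ] (h : IsLift f μ μbar) : IsFiniteMeasure μbar :=
  ⟨h.measure_univ_eq ▸ measure_lt_top μ univ⟩

theorem unique [IsFiniteMeasure μ] (hf : Measurable f) (h : IsLift f μ μbar) (h' : IsLift f μ ν) :
    μbar = ν := by
  have := h.isFiniteMeasure
  have coord_preimage (n k : ℕ) (A : Set M) : (fun z : PreOrbit f => z.1 n) ⁻¹' A =
      (fun z : PreOrbit f => z.1 (n + k)) ⁻¹' (f^[k] ⁻¹' A) := by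
    ext z
    simp only [mem_preimage, z.iterate_apply_add]
  refine ext_of_generate_finite _ generateFrom_coord_preimage.symm ?_ ?_
    (h.measure_univ_eq.trans h'.measure_univ_eq.symm)
  · rintro _ ⟨n, A, hA, rfl⟩ _ ⟨m, B, hB, rfl⟩ -
    refine ⟨n + m, f^[m] ⁻¹' A ∩ f^[n] ⁻¹' B,
      (hf.iterate m hA).inter (hf.iterate n hB), ?_⟩
    rw [coord_preimage n m A, coord_preimage m n B, Nat.add_comm m n, preimage_inter]
  · rintro _ ⟨n, A, hA, rfl⟩
    rw [h n A hA, h' n A hA]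

theorem measurePreserving [IsFiniteMeasure μ] (h : IsLift f μ μbar)
    (hf : MeasurePreserving f μ μ) : MeasurePreserving (natExt f) μbar μbar := by
  have hF := measurable_natExt hf.measurable
  refine ⟨hF, unique hf.measurable (fun n A hA => ?_) h⟩
  rw [Measure.map_apply hF (measurable_coord n hA)]
  simp only [preimage_preimage, natExt_apply]
  exact (h n _ (hf.measurable hA)).trans (hf.measure_preimage hA.nullMeasurableSet)

theorem measurePreserving_symm [IsFiniteMeasure μ] (h : IsLift f μ μbar)
    (hf : MeasurePreserving f μ μ) : MeasurePreserving (natExt f).symm μbar μbar :=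
  MeasurePreserving.symm (e := ⟨natExt f, measurable_natExt hf.measurable, measurable_natExt_symm⟩)
    (h.measurePreserving hf)

theorem measurePreserving_proj (h : IsLift f μ μbar) : MeasurePreserving (proj f) μbar μ :=
  ⟨measurable_coord 0, Measure.ext fun A hA =>
    (Measure.map_apply (measurable_coord 0) hA).trans (h 0 A hA)⟩

end IsLift

end Measure

section FirstReturn

/-- The points `u` of `S` whose first return to `S` under `F⁻¹` takes place at time `n`; the points
of `S` with first return time `n` under `F` are the preimages of this set under `Fⁿ`. -/
def backwardFirstReturnSet (f : M → M) (S : Set (PreOrbit f)) (n : ℕ) : Set (PreOrbit f) :=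
  {u | u ∈ S ∧ (natExt f).symm^[n] u ∈ S ∧ ∀ i, 0 < i → i < n → (natExt f).symm^[i] u ∉ S}

variable {S : Set (PreOrbit f)}

theorem disjoint_backwardFirstReturnSet {m n : ℕ} (hm : 0 < m) (hmn : m < n) :
    Disjoint (backwardFirstReturnSet f S m) (backwardFirstReturnSet f S n) :=
  disjoint_left.2 fun _ hum hun => hun.2.2 m hm hmn hum.2.1

theorem exists_mem_backwardFirstReturnSet {u : PreOrbit f} (hu : u ∈ S)
    (hret : ∃ n > 0, (natExt f).symm^[n] u ∈ S) : ∃ n > 0, u ∈ backwardFirstReturnSet f S n := by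
  classical
  obtain ⟨hpos, hmem⟩ := Nat.find_spec hret
  exact ⟨Nat.find hret, hpos, hu, hmem, fun i hi hin hiS => Nat.find_min hret hin ⟨hi, hiS⟩⟩

theorem mem_backImage_backwardFirstReturnSet {n : ℕ} {w : PreOrbit f} :
    w ∈ backImage f n (backwardFirstReturnSet f S n) ↔
      (natExt f)^[n] w ∈ S ∧ w ∈ S ∧ ∀ i, 0 < i → i < n → (natExt f)^[i] w ∉ S := by
  rw [mem_backImage, backwardFirstReturnSet, mem_ofPred_eq, natExt_symm_iterate_iterate]
  refine and_congr_right' (and_congr_right' ⟨fun h i hi hin => ?_, fun h i hi hin => ?_⟩)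
  · have := h (n - i) (by lia) (by lia)
    rwa [natExt_symm_iterate_iterate_of_le (by lia), Nat.sub_sub_self hin.le] at this
  · rw [natExt_symm_iterate_iterate_of_le hin.le]
    exact h (n - i) (by lia) (by lia)

theorem exists_mem_backImage_backwardFirstReturnSet {w : PreOrbit f} (hw : w ∈ S)
    (hret : ∃ n > 0, (natExt f)^[n] w ∈ S) :
    ∃ n > 0, w ∈ backImage f n (backwardFirstReturnSet f S n) := by
  classical
  obtain ⟨hpos, hmem⟩ := Nat.find_spec hret
  exact ⟨Nat.find hret, hpos, mem_backImage_backwardFirstReturnSet.2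
    ⟨hmem, hw, fun i hi hin hiS => Nat.find_min hret hin ⟨hi, hiS⟩⟩⟩

theorem firstReturnTime_eq {n : ℕ} (hn : 0 < n) {w : PreOrbit f}
    (hw : w ∈ backImage f n (backwardFirstReturnSet f S n)) : firstReturnTime f S w = n := by
  obtain ⟨hret, -, hmin⟩ := mem_backImage_backwardFirstReturnSet.1 hw
  refine IsLeast.csInf_eq ⟨⟨hn, hret⟩, fun i hi => ?_⟩
  by_contra! hin
  exact hmin i hi.1 hin hi.2

theorem disjoint_backImage_backwardFirstReturnSet {m n : ℕ} (hm : 0 < m) (hn : 0 < n)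
    (hmn : m ≠ n) : Disjoint (backImage f m (backwardFirstReturnSet f S m))
      (backImage f n (backwardFirstReturnSet f S n)) :=
  disjoint_left.2 fun _ hwm hwn => hmn ((firstReturnTime_eq hm hwm).symm.trans
    (firstReturnTime_eq hn hwn))

end FirstReturn

end NaturalExtension

section Perfect

variable {X Y : Type*} [TopologicalSpace X] [TopologicalSpace Y]

theorem preperfect_image_iff {φ : X → Y} (hφ : IsEmbedding φ) {A : Set X} :
    Preperfect (φ '' A) ↔ Preperfect A := by
  simp only [Preperfect, forall_mem_image, accPt_principal_iff_nhdsWithin, ← image_singleton,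
    ← image_sdiff hφ.injective, ← hφ.map_nhdsWithin_eq, map_neBot_iff]

theorem perfectSpace_coe_iff {A : Set X} : PerfectSpace A ↔ Preperfect A := by
  have := preperfect_image_iff (IsEmbedding.subtypeVal (p := (· ∈ A))) (A := univ)
  rw [Subtype.coe_image_univ] at this
  exact ⟨fun h => this.2 h.univ_preperfect, fun h => ⟨this.1 h⟩⟩

end Perfect

section Core

variable {X : Type*} [TopologicalSpace X] [HereditarilyLindelofSpace X] [MeasurableSpace X]
  {ν : Measure X} {D : Set X}

theorem measure_sdiff_support_restrict (hD : MeasurableSet D) :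
    ν (D \ (ν.restrict D).support) = 0 := by
  have := Measure.measure_compl_support (μ := ν.restrict D)
  rwa [Measure.restrict_apply' hD, inter_comm, ← Set.sdiff_eq] at this

theorem preperfect_inter_support_restrict (hν : ∀ x, ν {x} = 0) (hD : MeasurableSet D) :
    Preperfect (D ∩ (ν.restrict D).support) := by
  intro x hx
  rw [accPt_iff_nhds]
  intro U hU
  by_contra! hisolated
  have measure_pos := (Measure.mem_support_iff_forall x).1 hx.2 U hU
  rw [Measure.restrict_apply' hD] at measure_pos
  refine measure_pos.ne' (measure_mono_null (t := {x} ∪ D \ (ν.restrict D).support) ?_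
    (measure_union_null (hν x) (measure_sdiff_support_restrict hD)))
  rintro y ⟨hyU, hyD⟩
  exact or_iff_not_imp_right.2 fun hy => hisolated y ⟨hyU, hyD, not_not.1 fun h => hy ⟨hyD, h⟩⟩

end Core

namespace Rectangle

variable {d : ℕ} {M : Type*} [MetricSpace M] [ChartedSpace (EuclideanSpace ℝ (Fin d)) M]
  {f : M → M}

section Plaques

variable (T : Rectangle d f)

/-- The height of a rectangle, as a type. -/
abbrev Height : Type _ := ↥(crossSection f T.carrier T.center)

/-- The holonomy along the plaques to the height: the second component of the chart. -/
def hol (w : T.carrier) : T.Height := (T.chart w).2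

/-- The union of the plaques over a set of heights. -/
def sat (A : Set T.Height) : Set (PreOrbit f) := {w | ∃ hw : w ∈ T.carrier, T.hol ⟨w, hw⟩ ∈ A}

/-- The point with given coordinates in the chart: the point over `x` of the plaque of height
`k`. -/
def point (x : T.base) (k : T.Height) : PreOrbit f := (T.chart.symm (x, k)).1

instance : Nonempty T.Height := T.nonempty_height.to_subtype

instance : TotallyDisconnectedSpace T.Height :=
  totallyDisconnectedSpace_subtype_iff.2 T.isTotallyDisconnected_height

instance : LocallyCompactSpace T.Height := T.locallyCompact_height

instance : PerfectSpace T.Height := perfectSpace_coe_iff.2 T.preperfect_height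

instance [SecondCountableTopology M] : SecondCountableTopology T.Height :=
  (IsInducing.subtypeVal.comp IsInducing.subtypeVal).secondCountableTopology

variable {T} {z w : PreOrbit f} {A : Set T.Height}

theorem continuous_hol : Continuous T.hol := continuous_snd.comp T.chart.continuous

theorem continuous_point : Continuous fun p : T.base × T.Height => T.point p.1 p.2 :=
  continuous_subtype_val.comp T.chart.symm.continuous

theorem isOpen_base : IsOpen T.base :=
  (T.projIsDiffeo_plaque ⟨_, T.nonempty_height.some_mem⟩).1

theorem self_mem_plaque (hz : z ∈ T.carrier) : z ∈ T.plaque z := ⟨hz, hz, rfl⟩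

theorem plaque_subset_carrier : T.plaque z ⊆ T.carrier := fun _ h => h.1

theorem plaque_eq_of_mem (h : w ∈ T.plaque z) : T.plaque w = T.plaque z := by
  obtain ⟨hw, hz, hwz⟩ := h
  ext v
  simp only [plaque, mem_ofPred_eq, hwz, hw, hz, exists_true_left]

theorem hol_height (k : T.Height) : T.hol ⟨k.1, k.2.1⟩ = k := T.chart_snd_center k

theorem mem_plaque_height {k : T.Height} :
    w ∈ T.plaque k.1 ↔ ∃ hw : w ∈ T.carrier, T.hol ⟨w, hw⟩ = k :=
  ⟨fun ⟨hw, _, h⟩ => ⟨hw, h.trans (hol_height k)⟩,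
    fun ⟨hw, h⟩ => ⟨hw, k.2.1, h.trans (hol_height k).symm⟩⟩

theorem mem_plaque_hol (hz : z ∈ T.carrier) : z ∈ T.plaque (T.hol ⟨z, hz⟩).1 :=
  mem_plaque_height.2 ⟨hz, rfl⟩

theorem sat_subset_carrier : T.sat A ⊆ T.carrier := fun _ h => h.1

theorem mem_sat_of_mem_plaque (hz : z ∈ T.sat A) (hw : w ∈ T.plaque z) : w ∈ T.sat A := by
  obtain ⟨hw, _, hwz⟩ := hw
  have hol_eq : T.hol ⟨w, hw⟩ = T.hol ⟨z, hz.1⟩ := hwz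
  exact ⟨hw, hol_eq ▸ hz.2⟩

theorem mem_sat_height {k : T.Height} : k.1 ∈ T.sat A ↔ k ∈ A :=
  ⟨fun ⟨_, h⟩ => hol_height k ▸ h, fun h => ⟨k.2.1, (hol_height k).symm ▸ h⟩⟩

theorem sat_singleton (k : T.Height) : T.sat {k} = T.plaque k.1 :=
  Set.ext fun _ => mem_plaque_height.symm

theorem proj_mem_base (hw : w ∈ T.carrier) : proj f w ∈ T.base :=
  T.chart_fst ⟨w, hw⟩ ▸ Subtype.coe_prop _

theorem point_mem_plaque (x : T.base) (k : T.Height) : T.point x k ∈ T.plaque k.1 :=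
  mem_plaque_height.2 ⟨(T.chart.symm (x, k)).2, by simp only [hol, point, Subtype.coe_eta,
    T.chart.apply_symm_apply]⟩

theorem proj_point (x : T.base) (k : T.Height) : proj f (T.point x k) = x := by
  have := T.chart_fst (T.chart.symm (x, k))
  rw [T.chart.apply_symm_apply] at this
  exact this.symm

theorem hol_point (x : T.base) (k : T.Height) (h : T.point x k ∈ T.carrier) :
    T.hol ⟨T.point x k, h⟩ = k :=
  (mem_plaque_height.1 (point_mem_plaque x k)).2

theorem point_proj_hol (hw : w ∈ T.carrier) :
    T.point ⟨proj f w, proj_mem_base hw⟩ (T.hol ⟨w, hw⟩) = w := by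
  have chart_eq : T.chart ⟨w, hw⟩ = (⟨proj f w, proj_mem_base hw⟩, T.hol ⟨w, hw⟩) :=
    Prod.ext (Subtype.ext (T.chart_fst ⟨w, hw⟩)) rfl
  rw [point, ← chart_eq, T.chart.symm_apply_apply]

theorem projIsDiffeo_plaque_of_mem (hz : z ∈ T.carrier) :
    ProjIsDiffeo d f (T.plaque z) T.base := by
  rw [plaque_eq_of_mem (mem_plaque_hol hz), ← sat_singleton]
  exact T.projIsDiffeo_plaque _

theorem bijOn_proj_plaque (hz : z ∈ T.carrier) : BijOn (proj f) (T.plaque z) T.base :=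
  (projIsDiffeo_plaque_of_mem hz).2.1

end Plaques

section Transverse

variable (T : Rectangle d f)

theorem isSigmaCompact_carrier [SecondCountableTopology M] : IsSigmaCompact T.carrier := by
  have := ChartedSpace.locallyCompactSpace (EuclideanSpace ℝ (Fin d)) M
  have : LocallyCompactSpace T.base := isOpen_base.locallyCompactSpace
  have range_point : range (fun p : T.base × T.Height => T.point p.1 p.2) = T.carrier :=
    Subset.antisymm (range_subset_iff.2 fun p => plaque_subset_carrier (point_mem_plaque p.1 p.2))
      fun w hw => ⟨(_, _), point_proj_hol hw⟩
  exact range_point ▸ isSigmaCompact_range continuous_point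

variable [MeasurableSpace M] [BorelSpace M]

/-- The transverse measure of a rectangle: the measure of a set of heights is the measure of the
union of the plaques over it. -/
noncomputable def transverse (μbar : Measure (PreOrbit f)) : Measure T.Height :=
  (μbar.comap (Subtype.val : T.carrier → PreOrbit f)).map T.hol

variable [SecondCountableTopology M]

theorem measurableSet_carrier : MeasurableSet T.carrier := by
  obtain ⟨K, hK, hU⟩ := T.isSigmaCompact_carrier
  exact hU ▸ MeasurableSet.iUnion fun n => (hK n).isClosed.measurableSet

theorem transverse_apply (μbar : Measure (PreOrbit f)) {A : Set T.Height} (hA : MeasurableSet A) :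
    T.transverse μbar A = μbar (T.sat A) := by
  rw [transverse, Measure.map_apply continuous_hol.measurable hA,
    (MeasurableEmbedding.subtype_coe T.measurableSet_carrier).comap_apply]
  congr 1
  ext w
  exact ⟨fun ⟨u, hu, h⟩ => h ▸ ⟨u.2, hu⟩, fun ⟨hw, h⟩ => ⟨⟨w, hw⟩, h, rfl⟩⟩

theorem transverse_singleton (μbar : Measure (PreOrbit f)) (k : T.Height) :
    T.transverse μbar {k} = μbar (T.plaque k.1) := by
  rw [transverse_apply T μbar (measurableSet_singleton k), sat_singleton]

end Transverse

end Rectangle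

section Exponent

variable {d : ℕ} {M : Type*} [MetricSpace M] [ChartedSpace (EuclideanSpace ℝ (Fin d)) M]
  [RiemannianBundle (fun x : M => TangentSpace (𝓡 d) x)] [MeasurableSpace M]
  {f : M → M} {μ : Measure M} [NeZero μ] {χ : ℝ}

theorem IsLeastExponent.exponent_pos (hχ : IsLeastExponent d f μ χ)
    (hexp : IsExpandingMeasure d f μ) : 0 < χ := by
  obtain ⟨x, hx, ⟨v, hv, hvχ⟩, -⟩ := (hexp.and hχ).exists
  obtain ⟨l, hl, hvl⟩ := hx v hv
  rwa [tendsto_nhds_unique hvχ hvl]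

theorem IsLeastExponent.dim_pos (hχ : IsLeastExponent d f μ χ) : 0 < d := by
  obtain ⟨x, ⟨v, hv, -⟩, -⟩ := Eventually.exists hχ
  have : Nontrivial (TangentSpace (𝓡 d) x) := ⟨v, 0, hv⟩
  by_contra hd
  obtain rfl : d = 0 := Nat.eq_zero_of_not_pos hd
  exact hv (Subsingleton.elim (α := EuclideanSpace ℝ (Fin 0)) v 0)

end Exponent

theorem disjointOrNested_backImage {M : Type*} {f : M → M} {n : ℕ} {P Q : Set (PreOrbit f)} :
    DisjointOrNested (backImage f n P) (backImage f n Q) ↔ DisjointOrNested P Q := by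
  have surj : Function.Surjective (natExt f)^[n] := (natExt f).surjective.iterate n
  simp only [DisjointOrNested, backImage, disjoint_preimage_iff surj,
    surj.preimage_subset_preimage_iff]

theorem IsLift.exists_frequently_iterate_mem {M : Type*} [TopologicalSpace M]
    [SecondCountableTopology M] [MeasurableSpace M] [OpensMeasurableSpace M] {f : M → M}
    {μ : Measure M} [IsFiniteMeasure μ] {μbar : Measure (PreOrbit f)} (h : IsLift f μ μbar)
    (hf : MeasurePreserving f μ μ) {S : Set (PreOrbit f)} (hS : MeasurableSet S)
    (hS0 : μbar S ≠ 0) (n : ℕ) :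
    ∃ y, proj f y ∈ μ.support ∧ ∃ᶠ l in atTop, (natExt f)^[n * l] y ∈ S := by
  have := h.isFiniteMeasure
  have conservative : Conservative (natExt f)^[n] μbar :=
    ((h.measurePreserving hf).iterate n).conservative
  have proj_mem_support : ∀ᵐ y ∂μbar, proj f y ∈ μ.support :=
    h.measurePreserving_proj.quasiMeasurePreserving.ae μ.support_mem_ae
  obtain ⟨y, ⟨-, hy⟩, hys⟩ := ((conservative.frequently_ae_mem_and_frequently_image_mem
    hS.nullMeasurableSet hS0).and_eventually proj_mem_support).exists
  simp only [← Function.iterate_mul] at hy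
  exact ⟨y, hys, hy⟩

namespace Rectangle

variable {d : ℕ} {M : Type*} [MetricSpace M] [ChartedSpace (EuclideanSpace ℝ (Fin d)) M]
  {f : M → M} (T : Rectangle d f)

/-- The projection of the pull-back by `Fⁿ` of the plaque through `z`: in a rectangle with regular
returns, the domain of a branch of `fⁿ` over the base. -/
def branchDomain (n : ℕ) (z : PreOrbit f) : Set M := proj f '' backImage f n (T.plaque z)

/-- The domains of the branches of `fⁿ` are uniformly small with respect to `μ` for large `n`. -/
def HasShrinkingBranches [MeasurableSpace M] (μ : Measure M) : Prop :=
  ∀ ε ≠ 0, ∀ᶠ n in atTop, ∀ z ∈ T.carrier, μ (T.branchDomain n z) < ε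

/-- The Markov property: the pull-back of a plaque by an iterate of `F` which meets the rectangle
is contained in a plaque. -/
def IsMarkov : Prop :=
  ∀ n > 0, ∀ z ∈ T.carrier, (natExt f)^[n] z ∈ T.carrier →
    backImage f n (T.plaque ((natExt f)^[n] z)) ⊆ T.plaque z

variable {T} {n : ℕ} {z : PreOrbit f}

theorem proj_mem_branchDomain (hz : (natExt f)^[n] z ∈ T.carrier) :
    proj f z ∈ T.branchDomain n ((natExt f)^[n] z) := ⟨z, self_mem_plaque hz, rfl⟩

theorem proj_symm_iterate_mem_branchDomain (hz : z ∈ T.carrier) :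
    proj f ((natExt f).symm^[n] z) ∈ T.branchDomain n z :=
  ⟨_, symm_iterate_mem_backImage.2 (self_mem_plaque hz), rfl⟩

theorem IsMarkov.backImage_plaque_eq (hT : T.IsMarkov) (hn : 0 < n) (hz : z ∈ T.carrier)
    (hnz : (natExt f)^[n] z ∈ T.carrier) :
    backImage f n (T.plaque ((natExt f)^[n] z)) =
      T.plaque z ∩ proj f ⁻¹' T.branchDomain n ((natExt f)^[n] z) := by
  have sub := hT n hn z hz hnz
  refine Subset.antisymm (subset_inter sub (subset_preimage_image _ _)) ?_
  rintro w ⟨hw, w', hw', hww'⟩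
  rwa [← (bijOn_proj_plaque hz).injOn (sub hw') hw hww']

end Rectangle

namespace HasRegularReturns

open Rectangle

variable {d : ℕ} {M : Type*} [MetricSpace M] [ChartedSpace (EuclideanSpace ℝ (Fin d)) M]
  [RiemannianBundle (fun x : M => TangentSpace (𝓡 d) x)]
  {f : M → M} {T : Rectangle d f} {χ C : ℝ} {m n : ℕ} {z z' : PreOrbit f}

theorem isOpen_branchDomain (hT : HasRegularReturns T χ C) (hn : 0 < n) (hz : z ∈ T.carrier) :
    IsOpen (T.branchDomain n z) := (hT.isDiffeoOn z hz n hn).1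

theorem bijOn_branchDomain (hT : HasRegularReturns T χ C) (hn : 0 < n) (hz : z ∈ T.carrier) :
    BijOn f^[n] (T.branchDomain n z) T.base := (hT.isDiffeoOn z hz n hn).bijOn

theorem branchDomain_eq_of_subset (hT : HasRegularReturns T χ C) (hn : 0 < n)
    (hz : z ∈ T.carrier) (hz' : z' ∈ T.carrier)
    (hsub : T.branchDomain n z ⊆ T.branchDomain n z') :
    T.branchDomain n z = T.branchDomain n z' := by
  have bij := hT.bijOn_branchDomain hn hz'
  rw [← bij.injOn.image_eq_image_iff hsub Subset.rfl, bij.image_eq,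
    (hT.bijOn_branchDomain hn hz).image_eq]

theorem branchDomain_eq_of_mem (hT : HasRegularReturns T χ C) (hn : 0 < n) (hz : z ∈ T.carrier)
    (hz' : z' ∈ T.carrier) {x : M} (hx : x ∈ T.branchDomain n z)
    (hx' : x ∈ T.branchDomain n z') : T.branchDomain n z = T.branchDomain n z' := by
  rcases hT.nested_proj z hz z' hz' n n hn hn with h | h | h
  · exact absurd hx' (disjoint_left.1 h hx)
  · exact hT.branchDomain_eq_of_subset hn hz hz' h
  · exact (hT.branchDomain_eq_of_subset hn hz' hz h).symm

section Shrinking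

variable [MeasurableSpace M] {μ : Measure M}

theorem eventually_branchDomain_subset (hT : HasRegularReturns T χ C)
    (hshrink : T.HasShrinkingBranches μ) (hm : 0 < m) (hz : z ∈ T.carrier) {x : M}
    (hx : x ∈ T.branchDomain m z) (hxμ : x ∈ μ.support) :
    ∀ᶠ n in atTop, ∀ z' ∈ T.carrier, x ∈ T.branchDomain n z' →
      T.branchDomain n z' ⊆ T.branchDomain m z := by
  have measure_pos : 0 < μ (T.branchDomain m z) :=
    (Measure.mem_support_iff_forall x).1 hxμ _ ((hT.isOpen_branchDomain hm hz).mem_nhds hx)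
  filter_upwards [hshrink _ measure_pos.ne', eventually_gt_atTop 0] with n hlt hn z' hz' hxz'
  rcases hT.nested_proj z' hz' z hz n m hn hm with h | h | h
  · exact absurd hx (disjoint_left.1 h hxz')
  · exact h
  · exact absurd (hlt z' hz') (measure_mono h).not_gt

variable [BorelSpace M] [IsFiniteMeasure μ] {μbar : Measure (PreOrbit f)}

theorem measure_plaque (hT : HasRegularReturns T χ C) (hshrink : T.HasShrinkingBranches μ)
    (hf : MeasurePreserving f μ μ) (hlift : IsLift f μ μbar) (hz : z ∈ T.carrier) :
    μbar (T.plaque z) = 0 := by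
  by_contra hne
  obtain ⟨n, hlt, hn⟩ := ((hshrink _ hne).and (eventually_gt_atTop 0)).exists
  refine (hlt z hz).not_ge ?_
  calc μbar (T.plaque z) ≤ μbar ((natExt f).symm^[n] ⁻¹' backImage f n (T.plaque z)) :=
        measure_mono fun w hw => symm_iterate_mem_backImage.2 hw
    _ ≤ μbar (backImage f n (T.plaque z)) :=
        ((hlift.measurePreserving_symm hf).iterate n).measure_preimage_le _
    _ ≤ μbar (proj f ⁻¹' T.branchDomain n z) := measure_mono (subset_preimage_image _ _)
    _ = μ (T.branchDomain n z) := hlift.measurePreserving_proj.measure_preimage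
        (hT.isOpen_branchDomain hn hz).measurableSet.nullMeasurableSet

variable [SecondCountableTopology M]

theorem hasShrinkingBranches [IsRiemannianManifold (𝓡 d) M]
    (hT : HasRegularReturns T χ C) (hχ : 0 < χ) (hd : 0 < d) (hvol : riemVolume d M T.base ≠ ⊤)
    (hμ : μ ≪ riemVolume d M) : T.HasShrinkingBranches μ := by
  intro ε hε
  obtain ⟨δ, hδ, hδε⟩ := exists_pos_forall_measure_lt_of_absolutelyContinuous hμ hε
  let c (n : ℕ) : ℝ := C⁻¹ * Real.exp (n * χ / 2)
  have c_tendsto : Tendsto c atTop atTop :=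
    Tendsto.const_mul_atTop (inv_pos.2 hT.const_pos) (Real.tendsto_exp_atTop.comp
      ((tendsto_natCast_atTop_atTop.atTop_mul_const hχ).atTop_div_const two_pos))
  have bound_tendsto : Tendsto (fun n => ENNReal.ofReal (c n)⁻¹ ^ (d : ℝ) *
      riemVolume d M T.base) atTop (𝓝 0) := by
    have := ((ENNReal.continuous_rpow_const (y := (d : ℝ))).tendsto _).comp
      (ENNReal.tendsto_ofReal c_tendsto.inv_tendsto_atTop)
    rw [ENNReal.ofReal_zero, ENNReal.zero_rpow_of_pos (by exact_mod_cast hd)] at this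
    have := ENNReal.Tendsto.mul_const this (Or.inr hvol)
    rwa [zero_mul] at this
  filter_upwards [bound_tendsto.eventually_lt_const hδ, eventually_gt_atTop 0] with n hnδ hn z hz
  refine hδε _ ((riemVolume_le_of_expanding (hT.isDiffeoOn z hz n hn)
    (mul_pos (inv_pos.2 hT.const_pos) (Real.exp_pos _)) ?_).trans_lt hnδ)
  rintro _ ⟨w, hw, rfl⟩ v
  exact hT.expansion z hz n hn w hw v

theorem base_subset_image_base (hT : HasRegularReturns T χ C) (hshrink : T.HasShrinkingBranches μ)
    (hf : MeasurePreserving f μ μ) (hlift : IsLift f μ μbar) (hpos : 0 < μbar T.carrier)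
    (hn : 0 < n) (hmaps : MapsTo f^[n] T.base T.base) : T.base ⊆ f^[n] '' T.base := by
  obtain ⟨y, hyμ, hy⟩ := hlift.exists_frequently_iterate_mem hf T.measurableSet_carrier hpos.ne' n
  obtain ⟨l₁, hl₁, hl₁pos⟩ := (hy.and_eventually (eventually_gt_atTop 0)).exists
  have nested := (tendsto_id.const_mul_atTop' hn).eventually
    (hT.eventually_branchDomain_subset hshrink (Nat.mul_pos hn hl₁pos) hl₁
      (proj_mem_branchDomain hl₁) hyμ)
  obtain ⟨l, hl, hsub, hlt⟩ := (hy.and_eventually (nested.and (eventually_gt_atTop l₁))).exists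
  -- Every point of the base is `f^[n * l] u` with `u` in a branch domain on which `f^[n * l₁]`
  -- already takes values in the base.
  intro x hx
  obtain ⟨u, hu, rfl⟩ :=
    (hT.bijOn_branchDomain (Nat.mul_pos hn (hl₁pos.trans hlt)) hl).surjOn hx
  have hu₁ := hsub _ hl (proj_mem_branchDomain hl) hu
  obtain ⟨i, rfl⟩ : ∃ i, l = 1 + i + l₁ := ⟨l - l₁ - 1, by lia⟩
  refine ⟨(f^[n])^[i] (f^[n * l₁] u), hmaps.iterate i
    ((hT.bijOn_branchDomain (Nat.mul_pos hn hl₁pos) hl₁).mapsTo hu₁), ?_⟩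
  rw [← Function.iterate_mul, ← Function.iterate_add_apply, ← Function.iterate_add_apply,
    mul_add, mul_add, mul_one]

theorem branchDomain_subset_base (hT : HasRegularReturns T χ C)
    (hshrink : T.HasShrinkingBranches μ) (hf : MeasurePreserving f μ μ) (hlift : IsLift f μ μbar)
    (hpos : 0 < μbar T.carrier) (hn : 0 < n) (hz : z ∈ T.carrier)
    (hsub : T.base ⊆ T.branchDomain n z) : T.branchDomain n z ⊆ T.base := by
  have bij := hT.bijOn_branchDomain hn hz
  refine (bij.injOn.image_subset_image_iff Subset.rfl hsub).1 (bij.image_eq.trans_subset ?_)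
  exact hT.base_subset_image_base hshrink hf hlift hpos hn (bij.mapsTo.mono_left hsub)

theorem isMarkov (hT : HasRegularReturns T χ C) (hshrink : T.HasShrinkingBranches μ)
    (hf : MeasurePreserving f μ μ) (hlift : IsLift f μ μbar) (hpos : 0 < μbar T.carrier) :
    T.IsMarkov := by
  intro n hn z hz hnz
  have nested := hT.nested _ hnz z hz (1 + n) 1 (by lia) one_pos
  rw [backImage_add, disjointOrNested_backImage] at nested
  rcases nested with h | h | h
  · exact absurd (self_mem_plaque hz) (disjoint_left.1 h (self_mem_plaque hnz))
  · exact h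
  · have base_subset : T.base ⊆ T.branchDomain n ((natExt f)^[n] z) :=
      (bijOn_proj_plaque hz).image_eq ▸ image_mono h
    intro w hw
    obtain ⟨w', hw', hww'⟩ := (bijOn_proj_plaque hz).surjOn
      (hT.branchDomain_subset_base hshrink hf hlift hpos hn hnz base_subset ⟨w, hw, rfl⟩)
    rwa [← (hT.projIsDiffeo _ hnz n hn).2.1.injOn (h hw') hw hww']

end Shrinking

end HasRegularReturns

theorem IsOpenDisc.nonempty {d : ℕ} {M : Type*} [MetricSpace M]
    [ChartedSpace (EuclideanSpace ℝ (Fin d)) M] {B : Set M} (hB : IsOpenDisc d B) :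
    B.Nonempty := by
  obtain ⟨x, r, hr, g, hg⟩ := hB
  exact (hg.bijOn.surjOn (Metric.mem_ball_self hr)).imp fun _ h => h.1

namespace Rectangle

variable {d : ℕ} {M : Type*} [MetricSpace M] [ChartedSpace (EuclideanSpace ℝ (Fin d)) M]
  {f : M → M}

section OfHomeomorph

variable {S : Set (PreOrbit f)} {B : Set M} {K : Type*} [TopologicalSpace K]

/-- In a product structure whose first component is `π`, the cross-sections are copies of the
second factor. -/
def crossSectionHomeomorph (Φ : S ≃ₜ B × K) (hΦ : ∀ w, ((Φ w).1 : M) = proj f w) (c : B) :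
    crossSection f S c ≃ₜ K where
  toFun v := (Φ ⟨v.1, v.2.1⟩).2
  invFun k := ⟨(Φ.symm (c, k)).1, (Φ.symm (c, k)).2, by rw [← hΦ, Φ.apply_symm_apply]⟩
  left_inv v := by
    have chart_eq : Φ ⟨v.1, v.2.1⟩ = (c, (Φ ⟨v.1, v.2.1⟩).2) :=
      Prod.ext (Subtype.ext ((hΦ _).trans v.2.2)) rfl
    simp only [← chart_eq, Φ.symm_apply_apply]
  right_inv k := by simp only [Subtype.coe_eta, Φ.apply_symm_apply]
  continuous_toFun := by fun_prop
  continuous_invFun := by fun_prop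

variable [Nonempty K] [TotallyDisconnectedSpace K] [LocallyCompactSpace K] [PerfectSpace K]

/-- The rectangle given by a product structure on `S` over the disc `B` with second factor `K`. -/
noncomputable def ofHomeomorph (hB : IsOpenDisc d B) (Φ : S ≃ₜ B × K)
    (hΦ : ∀ w, ((Φ w).1 : M) = proj f w)
    (hplaque : ∀ k, ProjIsDiffeo d f {w | ∃ hw : w ∈ S, (Φ ⟨w, hw⟩).2 = k} B) :
    Rectangle d f :=
  let c : B := ⟨_, hB.nonempty.some_mem⟩
  let e := crossSectionHomeomorph Φ hΦ c
  { carrier := S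
    base := B
    isOpenDisc_base := hB
    center := c
    center_mem := c.2
    nonempty_height := nonempty_coe_sort.1 e.toEquiv.nonempty
    isTotallyDisconnected_height :=
      totallyDisconnectedSpace_subtype_iff.1 e.symm.totallyDisconnectedSpace
    preperfect_height := by
      have := (preperfect_image_iff (IsEmbedding.subtypeVal.comp e.symm.isEmbedding)).2
        (PerfectSpace.univ_preperfect (α := K))
      rwa [image_univ, e.symm.surjective.range_comp, Subtype.range_val] at this
    locallyCompact_height := e.isClosedEmbedding.locallyCompactSpace
    chart := Φ.trans ((Homeomorph.refl B).prodCongr e.symm)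
    chart_fst := hΦ
    chart_snd_center := e.symm_apply_apply
    projIsDiffeo_plaque := fun k => by
      convert hplaque (e k) using 5
      exact e.toEquiv.symm_apply_eq }

theorem mem_plaque_ofHomeomorph (hB : IsOpenDisc d B) (Φ : S ≃ₜ B × K)
    (hΦ : ∀ w, ((Φ w).1 : M) = proj f w)
    (hplaque : ∀ k, ProjIsDiffeo d f {w | ∃ hw : w ∈ S, (Φ ⟨w, hw⟩).2 = k} B)
    {z w : PreOrbit f} (hz : z ∈ S) (hw : w ∈ S) :
    w ∈ (ofHomeomorph hB Φ hΦ hplaque).plaque z ↔ (Φ ⟨w, hw⟩).2 = (Φ ⟨z, hz⟩).2 :=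
  ⟨fun ⟨_, _, h⟩ => (crossSectionHomeomorph Φ hΦ _).symm.injective h,
    fun h => ⟨hw, hz, congrArg (crossSectionHomeomorph Φ hΦ _).symm h⟩⟩

end OfHomeomorph

end Rectangle

namespace Rectangle

variable {d : ℕ} {M : Type*} [MetricSpace M] [ChartedSpace (EuclideanSpace ℝ (Fin d)) M]
  {f : M → M} (T : Rectangle d f)

section Restrict

variable (D : Set T.Height)

/-- The chart of `T` over a set of heights. -/
def restrictChart : T.sat D ≃ₜ T.base × D where
  toFun w := (⟨proj f w, proj_mem_base w.2.1⟩, ⟨T.hol ⟨w, w.2.1⟩, w.2.2⟩)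
  invFun p := ⟨T.point p.1 p.2, mem_sat_of_mem_plaque (mem_sat_height.2 p.2.2)
    (point_mem_plaque p.1 p.2)⟩
  left_inv w := Subtype.ext (point_proj_hol w.2.1)
  right_inv p := Prod.ext (Subtype.ext (proj_point p.1 p.2)) (Subtype.ext (hol_point p.1 p.2 _))
  continuous_toFun := ((continuous_proj.comp continuous_subtype_val).subtype_mk _).prodMk
    ((continuous_hol.comp (continuous_subtype_val.subtype_mk _)).subtype_mk _)
  continuous_invFun := (continuous_point.comp
    (continuous_fst.prodMk (continuous_subtype_val.comp continuous_snd))).subtype_mk _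

theorem setOf_restrictChart_snd_eq (k : D) :
    {w | ∃ hw : w ∈ T.sat D, (T.restrictChart D ⟨w, hw⟩).2 = k} = T.plaque k.1.1 := by
  ext w
  rw [mem_plaque_height]
  exact ⟨fun ⟨hw, h⟩ => ⟨hw.1, congrArg Subtype.val h⟩,
    fun ⟨hw, h⟩ => ⟨⟨hw, h ▸ k.2⟩, Subtype.ext h⟩⟩

variable [Nonempty D] [LocallyCompactSpace D] [PerfectSpace D]

/-- The rectangle formed by the plaques of `T` over a set of heights. -/
noncomputable def restrict : Rectangle d f :=
  ofHomeomorph T.isOpenDisc_base (T.restrictChart D) (fun _ => rfl) fun k => by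
    rw [setOf_restrictChart_snd_eq]
    exact projIsDiffeo_plaque_of_mem k.1.2.1

theorem restrict_carrier : (T.restrict D).carrier = T.sat D := rfl

variable {T D} {z : PreOrbit f}

theorem plaque_restrict (hz : z ∈ T.sat D) : (T.restrict D).plaque z = T.plaque z := by
  ext w
  constructor
  · rintro ⟨hw, hz, h⟩
    exact ⟨hw.1, hz.1, congrArg Subtype.val
      ((mem_plaque_ofHomeomorph _ (T.restrictChart D) _ _ hz hw).1 ⟨hw, hz, h⟩)⟩
  · intro hw
    refine (mem_plaque_ofHomeomorph _ (T.restrictChart D) _ _ hz (mem_sat_of_mem_plaque hz hw)).2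
      (Subtype.ext ?_)
    obtain ⟨_, _, h⟩ := hw
    exact h

theorem isURectangle_restrict : (T.restrict D).IsURectangle T := by
  have inter_plaque : ∀ z ∈ T.sat D, T.sat D ∩ T.plaque z = T.plaque z := fun z hz =>
    inter_eq_right.2 fun w hw => mem_sat_of_mem_plaque hz hw
  exact ⟨⟨sat_subset_carrier, fun z hz => by
    rw [restrict_carrier, inter_plaque z hz, plaque_restrict hz]⟩, inter_plaque⟩

end Restrict

section Pullback

/-- All the plaques of `T` pull back under `Fⁿ` to plaques over one and the same disc `W`. -/
structure IsCommonBranchDomain (n : ℕ) (W : Set M) : Prop where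
  isDiffeoOn : IsDiffeoOn d f^[n] W T.base
  projIsDiffeo : ∀ z ∈ T.carrier, ProjIsDiffeo d f (backImage f n (T.plaque z)) W

namespace IsCommonBranchDomain

variable {T} {n : ℕ} {W : Set M} (h : T.IsCommonBranchDomain n W)
include h

theorem proj_mem {w : PreOrbit f} (hw : w ∈ backImage f n T.carrier) : proj f w ∈ W :=
  (h.projIsDiffeo _ hw).2.1.mapsTo (self_mem_plaque hw)

theorem continuousOn_iterate : ContinuousOn f^[n] W := h.isDiffeoOn.2.2.1.continuousOn

theorem continuousOn_iterate_of_add_eq {i j : ℕ} (hij : i + j = n) : ContinuousOn f^[j] W := by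
  -- On `W`, `f^[j]` factors as an inverse branch of `f^[i]` after `f^[n]`.
  obtain ⟨k⟩ : Nonempty T.Height := inferInstance
  obtain ⟨-, -, inverse_branches⟩ := projIsDiffeo_plaque_of_mem k.2.1
  obtain ⟨g, hg, hgk⟩ := inverse_branches i
  refine (hg.continuousOn.comp h.continuousOn_iterate h.isDiffeoOn.bijOn.mapsTo).congr
    fun x hx => ?_
  obtain ⟨w, hw, rfl⟩ := (h.projIsDiffeo _ k.2.1).2.1.surjOn hx
  rw [Function.comp_apply, ← proj_natExt_iterate n, hgk _ hw, ← hij, natExt_iterate_add_apply]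

theorem continuousOn_natExt_iterate :
    ContinuousOn (natExt f)^[n] (backImage f n T.carrier) := by
  rw [continuousOn_iff_continuous_domRestrict]
  refine Continuous.subtype_mk
    (f := fun w : backImage f n T.carrier => ((natExt f)^[n] w.1).1) (continuous_pi fun i => ?_) _
  rcases le_total i n with hi | hi
  · obtain ⟨j, rfl⟩ := Nat.exists_eq_add_of_le hi
    simp only [natExt_iterate_add_apply]
    exact (h.continuousOn_iterate_of_add_eq rfl).comp_continuous
      (continuous_proj.comp continuous_subtype_val) fun w => h.proj_mem w.2
  · obtain ⟨j, rfl⟩ := Nat.exists_eq_add_of_le' hi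
    simp only [natExt_iterate_apply_add]
    exact (continuous_coord j).comp continuous_subtype_val

/-- The pull-back of the chart of `T` by `Fⁿ`. -/
def pullbackChart : backImage f n T.carrier ≃ₜ W × T.Height where
  toFun w := (⟨proj f w, h.proj_mem w.2⟩, T.hol ⟨(natExt f)^[n] w, w.2⟩)
  invFun p := ⟨(natExt f).symm^[n] (T.point ⟨f^[n] p.1, h.isDiffeoOn.bijOn.mapsTo p.1.2⟩ p.2),
    symm_iterate_mem_backImage.2 (plaque_subset_carrier (point_mem_plaque _ _))⟩
  left_inv w := Subtype.ext <| by
    simp only [← proj_natExt_iterate, point_proj_hol (show _ ∈ T.carrier from w.2),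
      natExt_symm_iterate_iterate]
  right_inv p := by
    have hp := point_mem_plaque ⟨f^[n] p.1, h.isDiffeoOn.bijOn.mapsTo p.1.2⟩ p.2
    refine Prod.ext (Subtype.ext (h.isDiffeoOn.bijOn.injOn (h.proj_mem
      (symm_iterate_mem_backImage.2 (plaque_subset_carrier hp))) p.1.2 ?_)) ?_
    · rw [← proj_natExt_iterate, natExt_iterate_symm_iterate, proj_point]
    · simp only [natExt_iterate_symm_iterate, hol_point]
  continuous_toFun := ((continuous_proj.comp continuous_subtype_val).subtype_mk _).prodMk
    (continuous_hol.comp ((continuousOn_iff_continuous_domRestrict.1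
      h.continuousOn_natExt_iterate).subtype_mk _))
  continuous_invFun := ((continuous_natExt_symm_iterate n).comp (continuous_point.comp
    (((h.continuousOn_iterate.comp_continuous (continuous_subtype_val.comp continuous_fst)
      fun p => p.1.2).subtype_mk _).prodMk continuous_snd))).subtype_mk _

theorem setOf_pullbackChart_snd_eq (k : T.Height) :
    {w | ∃ hw : w ∈ backImage f n T.carrier, (h.pullbackChart ⟨w, hw⟩).2 = k} =
      backImage f n (T.plaque k.1) :=
  Set.ext fun _ => mem_plaque_height.symm

/-- The rectangle formed by the pull-backs by `Fⁿ` of the plaques of `T`. -/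
noncomputable def pullback : Rectangle d f :=
  ofHomeomorph (.of_isDiffeoOn T.isOpenDisc_base h.isDiffeoOn) h.pullbackChart (fun _ => rfl)
    fun k => by
      rw [setOf_pullbackChart_snd_eq]
      exact h.projIsDiffeo _ k.2.1

theorem plaque_pullback {z : PreOrbit f} (hz : z ∈ backImage f n T.carrier) :
    h.pullback.plaque z = backImage f n (T.plaque ((natExt f)^[n] z)) := by
  ext w
  constructor
  · rintro ⟨hw, hz, hwz⟩
    exact ⟨hw, hz, (mem_plaque_ofHomeomorph _ h.pullbackChart _ _ hz hw).1 ⟨hw, hz, hwz⟩⟩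
  · rintro ⟨hw, _, hwz⟩
    exact (mem_plaque_ofHomeomorph _ h.pullbackChart _ _ hz hw).2 hwz

theorem isLaminatedDiffeo_pullback : IsLaminatedDiffeo n h.pullback T := by
  have surjective : Function.Surjective (natExt f)^[n] := (natExt f).surjective.iterate n
  refine ⟨⟨fun w hw => hw, ((natExt f).injective.iterate n).injOn, fun w hw => ?_⟩,
    h.continuousOn_natExt_iterate, (continuous_natExt_symm_iterate n).continuousOn,
    fun z hz => ?_, h.isDiffeoOn⟩
  · exact (image_preimage_eq _ surjective).superset hw
  · rw [h.plaque_pullback hz]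
    exact image_preimage_eq _ surjective

end IsCommonBranchDomain

end Pullback

end Rectangle

namespace Rectangle

variable {d : ℕ} {M : Type*} [MetricSpace M] [ChartedSpace (EuclideanSpace ℝ (Fin d)) M]
  {f : M → M} {S T U : Rectangle d f} {n : ℕ} {W : Set M} {w z : PreOrbit f}

section Subrectangles

theorem IsURectangle.plaque_eq (hU : U.IsURectangle T) (hz : z ∈ U.carrier) :
    U.plaque z = T.plaque z :=
  (hU.1.2 z hz).trans (hU.2 z hz)

theorem IsURectangle.base_eq (hU : U.IsURectangle T) : U.base = T.base := by
  obtain ⟨k⟩ : Nonempty U.Height := inferInstance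
  rw [← (bijOn_proj_plaque k.2.1).image_eq, ← (bijOn_proj_plaque (hU.1.1 k.2.1)).image_eq,
    hU.plaque_eq k.2.1]

theorem IsLaminatedDiffeo.carrier_eq (h : IsLaminatedDiffeo n S U) :
    S.carrier = backImage f n U.carrier := by
  refine Subset.antisymm h.1.mapsTo fun w hw => ?_
  obtain ⟨v, hv, hvw⟩ := h.1.surjOn hw
  rwa [← (natExt f).injective.iterate n hvw]

theorem IsLaminatedDiffeo.iterate_mem_plaque (h : IsLaminatedDiffeo n S U)
    (hS : S.IsSubrectangle T) (hU : U.IsSubrectangle T) (hz : z ∈ S.carrier)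
    (hw : w ∈ S.carrier ∩ T.plaque z) : (natExt f)^[n] w ∈ T.plaque ((natExt f)^[n] z) := by
  have image_mem : (natExt f)^[n] w ∈ U.plaque ((natExt f)^[n] z) :=
    h.2.2.2.1 z hz ▸ mem_image_of_mem _ (hS.2 z hz ▸ hw)
  rw [hU.2 _ (h.1.mapsTo hz)] at image_mem
  exact image_mem.2

theorem IsCommonBranchDomain.isSubrectangle_pullback (h : U.IsCommonBranchDomain n W)
    (hT : T.IsMarkov) (hU : U.IsURectangle T) (hn : 0 < n)
    (hsub : backImage f n U.carrier ⊆ T.carrier) : h.pullback.IsSubrectangle T := by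
  refine ⟨hsub, fun z hz => ?_⟩
  have hFz : (natExt f)^[n] z ∈ U.carrier := hz
  have branchDomain_eq : T.branchDomain n ((natExt f)^[n] z) = W := by
    rw [branchDomain, ← hU.plaque_eq hFz, (h.projIsDiffeo _ hFz).2.1.image_eq]
  have plaque_eq : h.pullback.plaque z = T.plaque z ∩ proj f ⁻¹' W := by
    rw [h.plaque_pullback hz, hU.plaque_eq hFz,
      hT.backImage_plaque_eq hn (hsub hz) (hU.1.1 hFz), branchDomain_eq]
  refine Subset.antisymm (fun w hw => ⟨plaque_subset_carrier hw, (plaque_eq ▸ hw).1⟩) ?_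
  rintro w ⟨hw, hwz⟩
  exact plaque_eq ▸ ⟨hwz, h.proj_mem hw⟩

end Subrectangles

section FirstReturnHeights

variable (T) in
/-- The heights of the plaques whose first return to `T` in backward time is at time `n`. -/
def firstReturnHeights (n : ℕ) : Set T.Height :=
  {k | k.1 ∈ backwardFirstReturnSet f T.carrier n}

theorem IsMarkov.symm_iterate_mem_carrier_iff (hT : T.IsMarkov) (hn : 0 < n)
    (hw : w ∈ T.plaque z) :
    (natExt f).symm^[n] w ∈ T.carrier ↔ (natExt f).symm^[n] z ∈ T.carrier := by
  have imp : ∀ {w z}, w ∈ T.plaque z → (natExt f).symm^[n] z ∈ T.carrier →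
      (natExt f).symm^[n] w ∈ T.carrier := fun {w z} hw hz => by
    have pullback_subset := hT n hn _ hz
    rw [natExt_iterate_symm_iterate] at pullback_subset
    exact plaque_subset_carrier (pullback_subset hw.2.1 (symm_iterate_mem_backImage.2 hw))
  exact ⟨imp (plaque_eq_of_mem hw ▸ self_mem_plaque hw.2.1), imp hw⟩

theorem IsMarkov.sat_firstReturnHeights (hT : T.IsMarkov) (hn : 0 < n) :
    T.sat (T.firstReturnHeights n) = backwardFirstReturnSet f T.carrier n := by
  have mem_iff : ∀ {w} (hw : w ∈ T.carrier), T.hol ⟨w, hw⟩ ∈ T.firstReturnHeights n ↔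
      w ∈ backwardFirstReturnSet f T.carrier n := fun {w} hw => by
    refine and_congr (iff_of_true (T.hol ⟨w, hw⟩).2.1 hw) (and_congr
      (hT.symm_iterate_mem_carrier_iff hn (mem_plaque_hol hw)).symm (forall_congr' fun i =>
        forall_congr' fun hi => imp_congr_right fun _ => not_congr
          (hT.symm_iterate_mem_carrier_iff hi (mem_plaque_hol hw)).symm))
  exact Set.ext fun w => ⟨fun ⟨hw, h⟩ => (mem_iff hw).1 h, fun h => ⟨h.1, (mem_iff h.1).2 h⟩⟩

theorem isClosed_crossSection (hcpt : IsCompact T.height) (x : M) :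
    IsClosed (crossSection f T.carrier x) := by
  have : CompactSpace T.Height := isCompact_iff_compactSpace.1 hcpt
  by_cases hx : x ∈ T.base
  · have range_point : range (T.point ⟨x, hx⟩) = crossSection f T.carrier x := by
      ext w
      constructor
      · rintro ⟨k, rfl⟩
        exact ⟨plaque_subset_carrier (point_mem_plaque _ _), proj_point _ _⟩
      · rintro ⟨hw, rfl⟩
        exact ⟨_, point_proj_hol hw⟩
    exact range_point ▸
      (isCompact_range (continuous_point.comp (Continuous.prodMk_right _))).isClosed
  · convert isClosed_empty
    refine eq_empty_of_forall_notMem fun w hw => hx (hw.2 ▸ proj_mem_base hw.1)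

end FirstReturnHeights

end Rectangle

namespace HasRegularReturns

open Rectangle

variable {d : ℕ} {M : Type*} [MetricSpace M] [ChartedSpace (EuclideanSpace ℝ (Fin d)) M]
  [RiemannianBundle (fun x : M => TangentSpace (𝓡 d) x)]
  {f : M → M} {T U : Rectangle d f} {χ C : ℝ} {n : ℕ} {W : Set M} (hT : HasRegularReturns T χ C)
include hT

theorem isCommonBranchDomain (hU : U.IsURectangle T) (hn : 0 < n)
    (hW : ∀ z ∈ U.carrier, T.branchDomain n z = W) : U.IsCommonBranchDomain n W where
  isDiffeoOn := by
    obtain ⟨k⟩ : Nonempty U.Height := inferInstance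
    rw [← hW _ k.2.1, hU.base_eq]
    exact hT.isDiffeoOn _ (hU.1.1 k.2.1) n hn
  projIsDiffeo z hz := by
    rw [← hW z hz, hU.plaque_eq hz]
    exact hT.projIsDiffeo z (hU.1.1 hz) n hn

theorem isLocallyConstant_branchDomain (hn : 0 < n) :
    IsLocallyConstant fun k : T.Height => T.branchDomain n k.1 := by
  rw [IsLocallyConstant.iff_eventually_eq]
  intro k
  have continuous_branch : Continuous fun k : T.Height => proj f ((natExt f).symm^[n] k.1) :=
    continuous_proj.comp ((continuous_natExt_symm_iterate n).comp continuous_subtype_val)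
  filter_upwards [continuous_branch.continuousAt ((hT.isOpen_branchDomain hn k.2.1).mem_nhds
    (proj_symm_iterate_mem_branchDomain k.2.1))] with k' hk'
  exact hT.branchDomain_eq_of_mem hn k'.2.1 k.2.1
    (proj_symm_iterate_mem_branchDomain k'.2.1) hk'

theorem isLocallyConstant_proj_symm_iterate (hn : 0 < n) :
    IsLocallyConstant fun k : T.Height => proj f ((natExt f).symm^[n] k.1) := by
  rw [IsLocallyConstant.iff_eventually_eq]
  intro k
  filter_upwards [(hT.isLocallyConstant_branchDomain hn).eventually_eq k] with k' hk'
  refine (hT.bijOn_branchDomain hn k.2.1).injOn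
    (hk' ▸ proj_symm_iterate_mem_branchDomain k'.2.1)
    (proj_symm_iterate_mem_branchDomain k.2.1) ?_
  rw [← proj_natExt_iterate, ← proj_natExt_iterate, natExt_iterate_symm_iterate,
    natExt_iterate_symm_iterate]
  exact k'.2.2.trans k.2.2.symm

theorem isClosed_setOf_symm_iterate_mem (hcpt : IsCompact T.height) (hn : 0 < n) :
    IsClosed {k : T.Height | (natExt f).symm^[n] k.1 ∈ T.carrier} := by
  have continuous_symm : Continuous fun k : T.Height => (natExt f).symm^[n] k.1 :=
    (continuous_natExt_symm_iterate n).comp continuous_subtype_val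
  rw [← isOpen_compl_iff, isOpen_iff_mem_nhds]
  intro k hk
  have symm_notMem : (natExt f).symm^[n] k.1 ∉
      crossSection f T.carrier (proj f ((natExt f).symm^[n] k.1)) := fun h => hk h.1
  filter_upwards [(hT.isLocallyConstant_proj_symm_iterate hn).eventually_eq k,
    continuous_symm.continuousAt ((isClosed_crossSection hcpt _).isOpen_compl.mem_nhds
      symm_notMem)] with k' hproj hk' hmem
  exact hk' ⟨hmem, hproj⟩

theorem isLocallyClosed_firstReturnHeights (hcpt : IsCompact T.height) (hn : 0 < n) :
    IsLocallyClosed (T.firstReturnHeights n) := by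
  let returnHeights (i : ℕ) : Set T.Height := {k | (natExt f).symm^[i] k.1 ∈ T.carrier}
  have eq_inter : T.firstReturnHeights n =
      returnHeights n ∩ ⋂ i ∈ Finset.Ioo 0 n, (returnHeights i)ᶜ := by
    ext k
    simp only [firstReturnHeights, backwardFirstReturnSet, returnHeights, mem_inter_iff,
      mem_ofPred_eq, mem_iInter, mem_compl_iff, Finset.mem_Ioo, and_imp, k.2.1, true_and]
  rw [eq_inter]
  exact (hT.isClosed_setOf_symm_iterate_mem hcpt hn).isLocallyClosed.inter
    (isOpen_biInter_finset fun i hi => (hT.isClosed_setOf_symm_iterate_mem hcpt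
      (Finset.mem_Ioo.1 hi).1).isOpen_compl).isLocallyClosed

end HasRegularReturns

section Recurrence

variable {M : Type*} [MeasurableSpace M] {f : M → M} {μ : Measure M} [IsFiniteMeasure μ]
  {μbar : Measure (PreOrbit f)} {S : Set (PreOrbit f)} {J : Type*} {R : J → ℕ}
  {U : J → Set (PreOrbit f)}

theorem IsLift.measure_sdiff_iUnion_eq_zero (h : IsLift f μ μbar) (hf : MeasurePreserving f μ μ)
    (hS : MeasurableSet S)
    (hU : ∀ m > 0, ∀ᵐ u ∂μbar, u ∈ backwardFirstReturnSet f S m → ∃ j, R j = m ∧ u ∈ U j) :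
    μbar (S \ ⋃ j, U j) = 0 := by
  have := h.isFiniteMeasure
  rw [measure_eq_zero_iff_ae_notMem]
  filter_upwards [ae_all_iff.2 fun m => ae_all_iff.2 (hU m),
    (h.measurePreserving_symm hf).conservative.ae_mem_imp_frequently_image_mem
      hS.nullMeasurableSet] with u hu recurrent
  rintro ⟨huS, huU⟩
  obtain ⟨n, hnu, hn⟩ := ((recurrent huS).and_eventually (eventually_gt_atTop 0)).exists
  obtain ⟨m, hm, hmu⟩ := exists_mem_backwardFirstReturnSet huS ⟨n, hn, hnu⟩
  obtain ⟨j, -, hj⟩ := hu m hm hmu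
  exact huU (mem_iUnion_of_mem j hj)

theorem IsLift.measure_sdiff_iUnion_backImage_eq_zero (h : IsLift f μ μbar)
    (hf : MeasurePreserving f μ μ) (hS : MeasurableSet S)
    (hU : ∀ m > 0, ∀ᵐ u ∂μbar, u ∈ backwardFirstReturnSet f S m → ∃ j, R j = m ∧ u ∈ U j) :
    μbar (S \ ⋃ j, backImage f (R j) (U j)) = 0 := by
  have := h.isFiniteMeasure
  have preserving := h.measurePreserving hf
  rw [measure_eq_zero_iff_ae_notMem]
  filter_upwards [ae_all_iff.2 fun m => ae_all_iff.2 fun hm =>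
      (preserving.iterate m).quasiMeasurePreserving.ae (hU m hm),
    preserving.conservative.ae_mem_imp_frequently_image_mem hS.nullMeasurableSet]
    with w hw recurrent
  rintro ⟨hwS, hwU⟩
  obtain ⟨n, hnw, hn⟩ := ((recurrent hwS).and_eventually (eventually_gt_atTop 0)).exists
  obtain ⟨m, hm, hmw⟩ := exists_mem_backImage_backwardFirstReturnSet hwS ⟨n, hn, hnw⟩
  obtain ⟨j, rfl, hj⟩ := hw m hm hmw
  exact hwU (mem_iUnion_of_mem j hj)

end Recurrence

theorem exists_injective_range_eq_of_countable {α : Type*} {s : Set α} (hs : s.Countable) :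
    ∃ (J : Type) (_ : Countable J) (p : J → α), Function.Injective p ∧ range p = s := by
  have := hs.to_subtype
  let e : Shrink.{0} s ≃ s := (equivShrink.{0} s).symm
  refine ⟨Shrink.{0} s, e.injective.countable, fun j => e j,
    Subtype.val_injective.comp e.injective, ?_⟩
  exact (e.surjective.range_comp Subtype.val).trans Subtype.range_coe

namespace Rectangle

variable {d : ℕ} {M : Type*} [MetricSpace M] [ChartedSpace (EuclideanSpace ℝ (Fin d)) M]
  {f : M → M} (T : Rectangle d f)

/-- The heights in `firstReturnHeights` over which the branch of `fⁿ` has domain `W`. -/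
def branchHeights (n : ℕ) (W : Set M) : Set T.Height :=
  T.firstReturnHeights n ∩ {k | T.branchDomain n k.1 = W}

variable [MeasurableSpace M]

/-- The part of `branchHeights` in the support of the transverse measure, which has no isolated
points when the plaques are null sets. -/
def essentialHeights (μbar : Measure (PreOrbit f)) (n : ℕ) (W : Set M) : Set T.Height :=
  T.branchHeights n W ∩ ((T.transverse μbar).restrict (T.branchHeights n W)).support

variable {T} {μbar : Measure (PreOrbit f)} {n : ℕ} {W : Set M}

theorem sat_essentialHeights_subset (hT : T.IsMarkov) (hn : 0 < n) :
    T.sat (T.essentialHeights μbar n W) ⊆ backwardFirstReturnSet f T.carrier n :=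
  fun _ hw => hT.sat_firstReturnHeights hn ▸ ⟨hw.1, hw.2.1.1⟩

end Rectangle

namespace HasRegularReturns

open Rectangle

variable {d : ℕ} {M : Type*} [MetricSpace M] [ChartedSpace (EuclideanSpace ℝ (Fin d)) M]
  [RiemannianBundle (fun x : M => TangentSpace (𝓡 d) x)]
  {f : M → M} {T : Rectangle d f} {χ C : ℝ} {n : ℕ} (hT : HasRegularReturns T χ C)
include hT

theorem isLocallyClosed_branchHeights (hcpt : IsCompact T.height) (hn : 0 < n) (W : Set M) :
    IsLocallyClosed (T.branchHeights n W) :=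
  (hT.isLocallyClosed_firstReturnHeights hcpt hn).inter
    ((hT.isLocallyConstant_branchDomain hn).isClosed_fiber W).isLocallyClosed

theorem finite_range_branchDomain (hcpt : IsCompact T.height) (hn : 0 < n) :
    (range fun k : T.Height => T.branchDomain n k.1).Finite := by
  have : CompactSpace T.Height := isCompact_iff_compactSpace.1 hcpt
  exact (hT.isLocallyConstant_branchDomain hn).range_finite

variable [MeasurableSpace M] [BorelSpace M] [SecondCountableTopology M]
  {μbar : Measure (PreOrbit f)}

theorem measurableSet_branchHeights (hcpt : IsCompact T.height) (hn : 0 < n) (W : Set M) :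
    MeasurableSet (T.branchHeights n W) := by
  obtain ⟨O, Z, hO, hZ, hOZ⟩ := hT.isLocallyClosed_branchHeights hcpt hn W
  exact hOZ ▸ hO.measurableSet.inter hZ.measurableSet

theorem measure_sat_branchHeights_sdiff (hcpt : IsCompact T.height) (hn : 0 < n) (W : Set M) :
    μbar (T.sat (T.branchHeights n W \ T.essentialHeights μbar n W)) = 0 := by
  have measurable := hT.measurableSet_branchHeights hcpt hn W
  rw [essentialHeights, sdiff_self_inter, ← transverse_apply T μbar
    (measurable.diff Measure.isClosed_support.measurableSet)]
  exact measure_sdiff_support_restrict measurable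

theorem ae_exists_mem_sat_essentialHeights (hM : T.IsMarkov) (hcpt : IsCompact T.height)
    (hn : 0 < n) : ∀ᵐ u ∂μbar, u ∈ backwardFirstReturnSet f T.carrier n →
      ∃ W, u ∈ T.sat (T.essentialHeights μbar n W) := by
  have ae_notMem := (ae_ball_iff (hT.finite_range_branchDomain hcpt hn).countable).2 fun W _ =>
    measure_eq_zero_iff_ae_notMem.1 (hT.measure_sat_branchHeights_sdiff (μbar := μbar) hcpt hn W)
  filter_upwards [ae_notMem] with u hu hfirst
  obtain ⟨hu_mem, hk⟩ := hM.sat_firstReturnHeights hn ▸ hfirst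
  refine ⟨_, hu_mem, not_not.1 fun h => hu _ (mem_range_self (T.hol ⟨u, hu_mem⟩))
    ⟨hu_mem, ⟨hk, rfl⟩, h⟩⟩

theorem exists_isLaminatedDiffeo (hM : T.IsMarkov) (hcpt : IsCompact T.height)
    (hplaque : ∀ z ∈ T.carrier, μbar (T.plaque z) = 0) (hn : 0 < n) {W : Set M}
    (hne : (T.essentialHeights μbar n W).Nonempty) :
    ∃ S U : Rectangle d f, S.IsSubrectangle T ∧ U.IsURectangle T ∧ IsLaminatedDiffeo n S U ∧
      U.carrier = T.sat (T.essentialHeights μbar n W) := by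
  have := hne.to_subtype
  have : LocallyCompactSpace (T.essentialHeights μbar n W) :=
    ((hT.isLocallyClosed_branchHeights hcpt hn W).inter
      Measure.isClosed_support.isLocallyClosed).locallyCompactSpace
  have : PerfectSpace (T.essentialHeights μbar n W) := perfectSpace_coe_iff.2 <|
    preperfect_inter_support_restrict
      (fun k => (T.transverse_singleton μbar k).trans (hplaque _ k.2.1))
      (hT.measurableSet_branchHeights hcpt hn W)
  have hU : (T.restrict (T.essentialHeights μbar n W)).IsURectangle T := isURectangle_restrict
  have branchDomain_eq : ∀ z ∈ T.sat (T.essentialHeights μbar n W), T.branchDomain n z = W :=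
    fun z hz => by
      rw [branchDomain, plaque_eq_of_mem (mem_plaque_hol hz.1)]
      exact hz.2.1.2
  have common := hT.isCommonBranchDomain hU hn branchDomain_eq
  refine ⟨common.pullback, _, common.isSubrectangle_pullback hM hU hn fun w hw => ?_, hU,
    common.isLaminatedDiffeo_pullback, rfl⟩
  have := (sat_essentialHeights_subset hM hn hw).2.1
  rwa [natExt_symm_iterate_iterate] at this

end HasRegularReturns

namespace Rectangle

variable {d : ℕ} {M : Type*} [MetricSpace M] [ChartedSpace (EuclideanSpace ℝ (Fin d)) M]
  [MeasurableSpace M] {f : M → M} {T : Rectangle d f} {μbar : Measure (PreOrbit f)}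
  {p q : ℕ × Set M}

variable (T μbar) in
/-- The pairs `(n, W)` of a return time and the domain of a branch of `fⁿ` along which first
returns occur; they index the pieces of the first return map. -/
def returnBranches : Set (ℕ × Set M) :=
  {p | 0 < p.1 ∧ (T.essentialHeights μbar p.1 p.2).Nonempty}

theorem disjoint_sat_essentialHeights (hT : T.IsMarkov) (hp : 0 < p.1) (hq : 0 < q.1)
    (hpq : p ≠ q) : Disjoint (T.sat (T.essentialHeights μbar p.1 p.2))
      (T.sat (T.essentialHeights μbar q.1 q.2)) := by
  obtain ⟨m, V⟩ := p
  obtain ⟨n, W⟩ := q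
  rcases lt_trichotomy m n with hmn | rfl | hnm
  · exact (disjoint_backwardFirstReturnSet hp hmn).mono (sat_essentialHeights_subset hT hp)
      (sat_essentialHeights_subset hT hq)
  · exact disjoint_left.2 fun _ hwV hwW =>
      hpq (congrArg _ (hwV.2.1.2.symm.trans hwW.2.1.2))
  · exact (disjoint_backwardFirstReturnSet hq hnm).symm.mono (sat_essentialHeights_subset hT hp)
      (sat_essentialHeights_subset hT hq)

theorem disjoint_backImage_sat_essentialHeights (hT : T.IsMarkov) (hp : 0 < p.1) (hq : 0 < q.1)
    (hpq : p ≠ q) : Disjoint (backImage f p.1 (T.sat (T.essentialHeights μbar p.1 p.2)))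
      (backImage f q.1 (T.sat (T.essentialHeights μbar q.1 q.2))) := by
  by_cases hn : p.1 = q.1
  · rw [hn]
    exact (hn ▸ disjoint_sat_essentialHeights hT hp hq hpq).preimage _
  · exact (disjoint_backImage_backwardFirstReturnSet hp hq hn).mono
      (preimage_mono (sat_essentialHeights_subset hT hp))
      (preimage_mono (sat_essentialHeights_subset hT hq))

/-- Up to null sets, the first return map of `T` is decomposed into laminated diffeomorphisms
`F^(R j) : S j → U j` of subrectangles onto `u`-rectangles, finitely many for each return time. -/
structure IsReturnPartition (T : Rectangle d f) (μbar : Measure (PreOrbit f)) {J : Type*}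
    (S U : J → Rectangle d f) (R : J → ℕ) : Prop where
  isSubrectangle : ∀ j, (S j).IsSubrectangle T
  isURectangle : ∀ j, (U j).IsURectangle T
  time_pos : ∀ j, 0 < R j
  pairwise_disjoint_source : Pairwise fun i j => Disjoint (S i).carrier (S j).carrier
  pairwise_disjoint_target : Pairwise fun i j => Disjoint (U i).carrier (U j).carrier
  measure_sdiff_source : μbar (T.carrier \ ⋃ j, (S j).carrier) = 0
  measure_sdiff_target : μbar (T.carrier \ ⋃ j, (U j).carrier) = 0
  isLaminatedDiffeo : ∀ j, IsLaminatedDiffeo (R j) (S j) (U j)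
  firstReturnTime_eq : ∀ j, ∀ w ∈ (S j).carrier, firstReturnTime f T.carrier w = R j
  finite_time_eq : ∀ m, {j | R j = m}.Finite

end Rectangle

namespace HasRegularReturns

open Rectangle

variable {d : ℕ} {M : Type*} [MetricSpace M] [ChartedSpace (EuclideanSpace ℝ (Fin d)) M]
  [RiemannianBundle (fun x : M => TangentSpace (𝓡 d) x)]
  {f : M → M} {T S U : Rectangle d f} {χ C : ℝ} {n : ℕ} (hT : HasRegularReturns T χ C)
include hT

theorem finite_returnBranches_fst [MeasurableSpace M] (hcpt : IsCompact T.height)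
    (μbar : Measure (PreOrbit f)) (n : ℕ) : {p ∈ T.returnBranches μbar | p.1 = n}.Finite := by
  rcases n.eq_zero_or_pos with rfl | hn
  · exact finite_empty.subset fun p hp => hp.1.1.ne' hp.2
  · refine ((hT.finite_range_branchDomain hcpt hn).image (Prod.mk n)).subset ?_
    rintro ⟨_, W⟩ ⟨⟨-, k, hk⟩, rfl⟩
    exact ⟨W, ⟨k, hk.1.2⟩, rfl⟩

theorem countable_returnBranches [MeasurableSpace M] (hcpt : IsCompact T.height)
    (μbar : Measure (PreOrbit f)) : (T.returnBranches μbar).Countable := by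
  refine (countable_iUnion fun n => (hT.finite_returnBranches_fst hcpt μbar n).countable).mono ?_
  exact fun p hp => mem_iUnion.2 ⟨p.1, hp, rfl⟩

theorem expansion_of_isLaminatedDiffeo (hS : S.IsSubrectangle T) (hU : U.IsSubrectangle T)
    (h : IsLaminatedDiffeo n S U) (hn : 0 < n) {w : PreOrbit f} (hw : w ∈ S.carrier)
    (v : TangentSpace (𝓡 d) (proj f w)) :
    C⁻¹ * Real.exp (n * χ / 2) * ‖v‖ ≤ ‖mfderiv (𝓡 d) (𝓡 d) f^[n] (proj f w) v‖ :=
  hT.expansion _ (hU.1 (h.1.mapsTo hw)) n hn w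
    (h.iterate_mem_plaque hS hU hw ⟨hw, self_mem_plaque (hS.1 hw)⟩) v

theorem distortion_of_isLaminatedDiffeo (hS : S.IsSubrectangle T) (hU : U.IsSubrectangle T)
    (h : IsLaminatedDiffeo n S U) (hn : 0 < n) {z w w' : PreOrbit f} (hz : z ∈ S.carrier)
    (hw : w ∈ S.carrier ∩ T.plaque z) (hw' : w' ∈ S.carrier ∩ T.plaque z) :
    riemJacobian d f^[n] (proj f w) / riemJacobian d f^[n] (proj f w') ≤
      Real.exp (C * dist (f^[n] (proj f w)) (f^[n] (proj f w'))) :=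
  hT.forward_distortion _ (hU.1 (h.1.mapsTo hz)) n hn
    w (h.iterate_mem_plaque hS hU hz hw) w' (h.iterate_mem_plaque hS hU hz hw')

theorem exists_isReturnPartition [SecondCountableTopology M] [MeasurableSpace M] [BorelSpace M]
    {μ : Measure M} [IsFiniteMeasure μ] {μbar : Measure (PreOrbit f)} (hM : T.IsMarkov)
    (hcpt : IsCompact T.height) (hf : MeasurePreserving f μ μ) (hlift : IsLift f μ μbar)
    (hplaque : ∀ z ∈ T.carrier, μbar (T.plaque z) = 0) :
    ∃ (J : Type) (_ : Countable J) (S U : J → Rectangle d f) (R : J → ℕ),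
      T.IsReturnPartition μbar S U R := by
  obtain ⟨J, hJ, p, p_inj, p_range⟩ :=
    exists_injective_range_eq_of_countable (hT.countable_returnBranches hcpt μbar)
  have hp (j : J) : p j ∈ T.returnBranches μbar := p_range ▸ mem_range_self j
  choose S U hS hU lam hUc using fun j =>
    hT.exists_isLaminatedDiffeo hM hcpt hplaque (hp j).1 (hp j).2
  have hSc (j : J) : (S j).carrier = backImage f (p j).1 (U j).carrier := (lam j).carrier_eq
  have cover (m : ℕ) (hm : 0 < m) : ∀ᵐ u ∂μbar, u ∈ backwardFirstReturnSet f T.carrier m →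
      ∃ j, (p j).1 = m ∧ u ∈ (U j).carrier := by
    filter_upwards [hT.ae_exists_mem_sat_essentialHeights hM hcpt hm] with u hu hfirst
    obtain ⟨W, hW⟩ := hu hfirst
    obtain ⟨j, hj⟩ : (m, W) ∈ range p := p_range ▸ ⟨hm, _, hW.2⟩
    exact ⟨j, congrArg Prod.fst hj, by rwa [hUc, hj]⟩
  refine ⟨J, hJ, S, U, fun j => (p j).1, hS, hU, fun j => (hp j).1, fun i j hij => ?_,
    fun i j hij => ?_, ?_, hlift.measure_sdiff_iUnion_eq_zero hf T.measurableSet_carrier cover,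
    lam, fun j w hw => ?_, fun m => ?_⟩
  · simpa only [hSc, hUc] using
      disjoint_backImage_sat_essentialHeights hM (hp i).1 (hp j).1 (p_inj.ne hij)
  · simpa only [hUc] using disjoint_sat_essentialHeights hM (hp i).1 (hp j).1 (p_inj.ne hij)
  · simpa only [hSc] using
      hlift.measure_sdiff_iUnion_backImage_eq_zero hf T.measurableSet_carrier cover
  · rw [hSc, hUc] at hw
    exact firstReturnTime_eq (hp j).1 (sat_essentialHeights_subset hM (hp j).1 hw)
  · exact ((hT.finite_returnBranches_fst hcpt μbar m).preimage p_inj.injOn).subset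
      fun j hj => ⟨hp j, hj⟩

end HasRegularReturns

open Rectangle

theorem mainTheorem3_general
    {d : ℕ} {M : Type*} [MetricSpace M] [SecondCountableTopology M]
    [ChartedSpace (EuclideanSpace ℝ (Fin d)) M]
    [RiemannianBundle (fun x : M => TangentSpace (𝓡 d) x)] [IsRiemannianManifold (𝓡 d) M]
    [MeasurableSpace M] [BorelSpace M]
    {f : M → M} {μ : Measure M} [IsFiniteMeasure μ] (hf : MeasurePreserving f μ μ)
    (hac : μ ≪ riemVolume d M) (hd : 0 < d) {χ : ℝ} (hχ : 0 < χ)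
    {μbar : Measure (PreOrbit f)} (hμbar : IsLift f μ μbar)
    {T : Rectangle d f} (hTcantor : IsCompact T.height) (hvol : riemVolume d M T.base ≠ ⊤)
    {C : ℝ} (hT : HasRegularReturns T χ C) (hpos : 0 < μbar T.carrier) :
    ∃ (J : Type) (_ : Countable J) (S U : J → Rectangle d f) (R : J → ℕ),
      (∀ j, (S j).IsSubrectangle T) ∧ (∀ j, (U j).IsURectangle T) ∧ (∀ j, 0 < R j) ∧
      Pairwise (fun i j => Disjoint (S i).carrier (S j).carrier) ∧
      Pairwise (fun i j => Disjoint (U i).carrier (U j).carrier) ∧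
      μbar (T.carrier \ ⋃ j, (S j).carrier) = 0 ∧
      μbar (T.carrier \ ⋃ j, (U j).carrier) = 0 ∧
      (∀ j, Rectangle.IsLaminatedDiffeo (R j) (S j) (U j)) ∧
      (∀ j, ∀ w ∈ (S j).carrier, firstReturnTime f T.carrier w = R j ∧
        firstReturnMap f T.carrier w = (natExt f)^[R j] w) ∧
      (∀ j, ∀ w ∈ (S j).carrier, ∀ v : TangentSpace (𝓡 d) (proj f w),
        C⁻¹ * Real.exp (R j * χ / 2) * ‖v‖ ≤ ‖mfderiv (𝓡 d) (𝓡 d) f^[R j] (proj f w) v‖) ∧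
      (∀ j, ∀ z ∈ (S j).carrier, ∀ w ∈ (S j).carrier ∩ T.plaque z,
        ∀ w' ∈ (S j).carrier ∩ T.plaque z,
          riemJacobian d f^[R j] (proj f w) / riemJacobian d f^[R j] (proj f w') ≤
            Real.exp (C * dist (f^[R j] (proj f w)) (f^[R j] (proj f w')))) ∧
      ∀ m : ℕ, {j | R j = m}.Finite := by
  have shrink := hT.hasShrinkingBranches hχ hd hvol hac
  obtain ⟨J, hJ, S, U, R, h⟩ := hT.exists_isReturnPartition
    (hT.isMarkov shrink hf hμbar hpos) hTcantor hf hμbar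
    fun z hz => hT.measure_plaque shrink hf hμbar hz
  have time (j : J) (w) (hw : w ∈ (S j).carrier) := h.firstReturnTime_eq j w hw
  exact ⟨J, hJ, S, U, R, h.isSubrectangle, h.isURectangle, h.time_pos,
    h.pairwise_disjoint_source, h.pairwise_disjoint_target, h.measure_sdiff_source,
    h.measure_sdiff_target, h.isLaminatedDiffeo,
    fun j w hw => ⟨time j w hw, by rw [firstReturnMap, time j w hw]⟩,
    fun j w hw => hT.expansion_of_isLaminatedDiffeo (h.isSubrectangle j) (h.isURectangle j).1
      (h.isLaminatedDiffeo j) (h.time_pos j) hw,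
    fun j z hz w hw w' => hT.distortion_of_isLaminatedDiffeo (h.isSubrectangle j)
      (h.isURectangle j).1 (h.isLaminatedDiffeo j) (h.time_pos j) hz hw,
    h.finite_time_eq⟩

theorem mainTheorem3
    {d : ℕ} {M : Type*} [MetricSpace M] [CompactSpace M]
    [ChartedSpace (EuclideanSpace ℝ (Fin d)) M] [IsManifold (𝓡 d) ∞ M]
    [RiemannianBundle (fun x : M => TangentSpace (𝓡 d) x)]
    [IsContMDiffRiemannianBundle (𝓡 d) ∞ (EuclideanSpace ℝ (Fin d))
      (fun x : M => TangentSpace (𝓡 d) x)]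
    [IsRiemannianManifold (𝓡 d) M]
    [MeasurableSpace M] [BorelSpace M]
    (f : M → M) (hf : IsC2Transformation d f) (hnd : IsNonDegenerate d f)
    (μ : Measure M) [IsProbabilityMeasure μ] (hergodic : Ergodic f μ)
    (hac : μ ≪ riemVolume d M) (hexp : IsExpandingMeasure d f μ) (hreg : IsRegularMeasure d f μ)
    (χ : ℝ) (hχ : IsLeastExponent d f μ χ)
    (μbar : Measure (PreOrbit f)) (hμbar : IsLift f μ μbar)
    (T : Rectangle d f) (hTcantor : IsCompact T.height)
    (C : ℝ) (hT : HasRegularReturns T χ C) (hpos : 0 < μbar T.carrier) :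
    ∃ (J : Type) (_ : Countable J) (S U : J → Rectangle d f) (R : J → ℕ),
      (∀ j, (S j).IsSubrectangle T) ∧ (∀ j, (U j).IsURectangle T) ∧ (∀ j, 0 < R j) ∧
      Pairwise (fun i j => Disjoint (S i).carrier (S j).carrier) ∧
      Pairwise (fun i j => Disjoint (U i).carrier (U j).carrier) ∧
      μbar (T.carrier \ ⋃ j, (S j).carrier) = 0 ∧
      μbar (T.carrier \ ⋃ j, (U j).carrier) = 0 ∧
      (∀ j, Rectangle.IsLaminatedDiffeo (R j) (S j) (U j)) ∧
      (∀ j, ∀ w ∈ (S j).carrier, firstReturnTime f T.carrier w = R j ∧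
        firstReturnMap f T.carrier w = (natExt f)^[R j] w) ∧
      (∀ j, ∀ z ∈ (S j).carrier, ∀ w ∈ (S j).carrier ∩ T.plaque z,
        ∀ v : TangentSpace (𝓡 d) (proj f w),
          C⁻¹ * Real.exp (R j * χ / 3) * ‖v‖ ≤ ‖mfderiv (𝓡 d) (𝓡 d) f^[R j] (proj f w) v‖) ∧
      (∀ j, ∀ z ∈ (S j).carrier, ∀ w ∈ (S j).carrier ∩ T.plaque z,
        ∀ w' ∈ (S j).carrier ∩ T.plaque z,
          riemJacobian d f^[R j] (proj f w) / riemJacobian d f^[R j] (proj f w') ≤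
            Real.exp (C * dist (f^[R j] (proj f w)) (f^[R j] (proj f w')))) ∧
      ∀ m : ℕ, 0 < m → {j | R j = m}.Finite := by
  have := isContinuousRiemannianBundle_of_isContMDiffRiemannianBundle (𝓡 d) ∞
    (EuclideanSpace ℝ (Fin d)) (fun x : M => TangentSpace (𝓡 d) x)
  have : IsManifold (𝓡 d) 1 M := IsManifold.of_le (n := ∞) (by norm_num)
  have := isLocallyFiniteMeasure_riemVolume d M
  have χ_pos := hχ.exponent_pos hexp
  obtain ⟨J, hJ, S, U, R, hS, hU, hR, hSd, hUd, hS0, hU0, lam, time, expand, distort, fin⟩ :=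
    mainTheorem3_general hergodic.toMeasurePreserving hac hχ.dim_pos χ_pos hμbar hTcantor
      (measure_ne_top_of_subset (subset_univ _) isCompact_univ.measure_ne_top) hT hpos
  refine ⟨J, hJ, S, U, R, hS, hU, hR, hSd, hUd, hS0, hU0, lam, time, fun j z _ w hw v => ?_,
    distort, fun m _ => fin m⟩
  refine le_trans ?_ (expand j w hw.1 v)
  have := hT.const_pos
  gcongr
  norm_num
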